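/- For $n\in\mathbb N$ let $N=\binom n2$, and let $(G_t)_{t=0}^{N}$ be the random graph process on $n$ vertices: $G_0$ is the empty graph, and for $0\le t<N$ the graph $G_{t+1}$ is obtained from $G_t$ by adding one edge chosen uniformly at random from those not already present, so that $G_N$ is complete. For a graph $G$ let $\mathrm{diam}(G)$ be its diameter and let $\mathrm{rc}(G)$ be its rainbow connection number, i.e. the minimum number of colours in a (not necessarily proper) colouring of the edges of $G$ such that every pair of vertices is joined by at least one path all of whose edges have distinct colours; both are $\infty$ if $G$ is disconnected. Let $\tau_{\mathcal D}$ be the smallest $t$ such that $\mathrm{diam}(G_t)\le 2$, and let $\tau_{\mathcal R}$ be the smallest $t$ such that $\mathrm{rc}(G_t)\le 2$. Then with high probability $\tau_{\mathcal D}=\tau_{\mathcal R}$, that is, $$\lim_{n\to\infty}\mathbb P\bigl(\tau_{\mathcal D}=\tau_{\mathcal R}\bigr)=1 .$$ -/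

import Mathlib

open Filter Topology

noncomputable section

namespace RainbowProcess

/-- A walk in an edge-coloured graph is a rainbow path if it is a path
and its edges have pairwise distinct colours. -/
def IsRainbowPath {V K : Type*} {G : SimpleGraph V} (C : G.EdgeLabeling K) {u v : V}
    (p : G.Walk u v) : Prop :=
  p.IsPath ∧
    (p.edges.attach.map fun e => C ⟨e.1, p.edges_subset_edgeSet e.2⟩).Nodup

/-- An edge colouring (not necessarily proper) is a rainbow colouring if every pair of vertices
is joined by at least one rainbow path. -/
def IsRainbowColouring {V K : Type*} {G : SimpleGraph V} (C : G.EdgeLabeling K) : Prop :=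
  ∀ u v : V, ∃ p : G.Walk u v, IsRainbowPath C p

/-- The rainbow connection number: the least number `k` of colours for which a rainbow colouring
of the edges with `k` colours exists, and `⊤` if there is none. -/
def rc {V : Type*} (G : SimpleGraph V) : ℕ∞ :=
  ⨅ (k : ℕ) (_ : ∃ C : G.EdgeLabeling (Fin k), IsRainbowColouring C), (k : ℕ∞)

/-- The property of having diameter at most `2`
(a disconnected graph has infinite extended diameter). -/
def PropD {V : Type*} (G : SimpleGraph V) : Prop := G.ediam ≤ 2

/-- The property of having rainbow connection number at most `2`. -/
def PropR {V : Type*} (G : SimpleGraph V) : Prop := rc G ≤ 2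

/-- The potential edges (unordered pairs of distinct vertices) not present in `G`. -/
def absentEdges {V : Type*} [Fintype V] (G : SimpleGraph V) : Finset (Sym2 V) :=
  (Set.toFinite (Gᶜ).edgeSet).toFinset

open Classical in
/-- One step of the process from `G`: add an edge chosen uniformly at random from those not
already present (a complete graph stays as it is; the process never takes such a step). -/
def step {V : Type*} [Fintype V] (G : SimpleGraph V) : PMF (SimpleGraph V) :=
  if h : (absentEdges G).Nonempty then
    (PMF.uniformOfFinset (absentEdges G) h).map fun e => G ⊔ SimpleGraph.fromEdgeSet {e}
  else PMF.pure G

/-- The joint law of the first states `(G_0, …, G_t)` of the process: `G_0` is the empty graph,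
and given `(G_0, …, G_t)`, the graph `G_{t+1}` is obtained from `G_t` by one random step. -/
def processLaw (V : Type*) [Fintype V] : (t : ℕ) → PMF (Fin (t + 1) → SimpleGraph V)
  | 0 => PMF.pure fun _ => ⊥
  | t + 1 => (processLaw V t).bind fun g =>
      (step (g (Fin.last t))).map fun H => Fin.snoc (α := fun _ => SimpleGraph V) g H

/-- The law of the random graph process `(G_t)_{t=0}^N`, `N = n.choose 2`, on `n` vertices. -/
def randomGraphProcess (n : ℕ) : PMF (Fin (n.choose 2 + 1) → SimpleGraph (Fin n)) :=
  processLaw (Fin n) (n.choose 2)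

/-- The hitting time of the property `P` along a trajectory `g`: the smallest `t` such that `g t`
has property `P` (`⊤` if there is none). -/
def hittingTime {V : Type*} {N : ℕ} (P : SimpleGraph V → Prop)
    (g : Fin (N + 1) → SimpleGraph V) : ℕ∞ :=
  ⨅ (t : Fin (N + 1)) (_ : P (g t)), ((t : ℕ) : ℕ∞)

/-- The probability of the event `E` under the discrete law `p` (every set is an event). -/
def prob {α : Type*} (p : PMF α) (E : Set α) : ENNReal := p.toOuterMeasure E

end RainbowProcess

end

/-!
# Hitting times of diameter two and of rainbow connection number two

A graph with rainbow connection number at most two has diameter at most two, so only the converse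
at the hitting time `τ` of diameter two is at stake. The idea is to trap `G_τ` between two random
graphs of which enough is known to two-colour every graph of diameter two in between.

*Deterministic part.* Let `G₁ ≤ G ≤ G₂` and let `G` have diameter at most two. In a uniformly
random two-colouring of the edges, a non-adjacent pair of vertices with codegree `d ≥ 1` fails to
have a bichromatic path of length two with probability `2 ^ (-d)`. Around the threshold the
expected number of failures grows with `n`, but each failure depends on few others, and the
asymmetric Local Lemma (`exists_forall_not_bad`) applies with the weights `(3 / 5) ^ d`. Its
hypothesis follows from the condition `WellSpread G₁ G₂`: pairs of bounded codegree in `G₁` are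
isolated from each other in `G₂`, and the remaining pairs which can use a given edge have small
total weight. This is `WellSpread.propR`. The condition is monotone: it persists if `G₁` grows and
`G₂` shrinks.

*Probabilistic part.* Give each potential edge an independent label, such that the edges of the
first label form a binomial random graph with `n p ^ 2 = 1.9 log n`, and the edges of the first two
labels one with edge probability `n ^ (-0.48)`. All estimates come from one computation
(`expect_edges_mul_codeg_le`): the stars at different vertices outside a fixed vertex set are
independent, hence the joint law of the codegrees of boundedly many pairs is controlled by a
product over the other vertices. Taking it at `s = 0` gives the first and second moments of the
number of pairs without common neighbours (`prb_not_propD_le`, `prb_propD_le`), so that the sparser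
graph has diameter more than two and the denser one has diameter at most two; taking it at
`s = 1 / 20` and `s = 3 / 5` gives `WellSpread` (`prb_not_wellSpread_le`).

*Transfer to the process.* The law of the process is invariant under permutations of the edges, and
any nested pair of graphs can be moved by such a permutation relative to another one as the
numbers of edges permit. Hence, for monotone events, the probability for `(G_{t₁}, G_{t₂})` is
at most a constant times the probability for the labelled graphs, where `t₁` and `t₂` are quantiles
of their numbers of edges (`prob_process_le`). With high probability `t₁ < τ ≤ t₂` and
`WellSpread G_{t₁} G_{t₂}`, and then `G_τ` has rainbow connection number two (`hittingTime_eq`).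
-/

noncomputable section

namespace RainbowProcess

open Finset

/-! ### Expectations with respect to product weights -/

section Indicator

open Classical in
/-- The indicator of a proposition, as a real number. -/
def ind (P : Prop) : ℝ := if P then 1 else 0

theorem ind_true {P : Prop} (h : P) : ind P = 1 := if_pos h

theorem ind_false {P : Prop} (h : ¬ P) : ind P = 0 := if_neg h

theorem ind_nonneg (P : Prop) : 0 ≤ ind P := by unfold ind; split_ifs <;> norm_num

theorem ind_mono {P Q : Prop} (h : P → Q) : ind P ≤ ind Q := by
  by_cases hP : P
  · rw [ind_true hP, ind_true (h hP)]
  · rw [ind_false hP]; exact ind_nonneg Q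

theorem ind_not (P : Prop) : ind (¬ P) = 1 - ind P := by
  by_cases hP : P <;> simp [ind, hP]

theorem ind_and (P Q : Prop) : ind (P ∧ Q) = ind P * ind Q := by
  by_cases hP : P <;> by_cases hQ : Q <;> simp [ind, hP, hQ]

theorem ind_forall {α : Type*} (s : Finset α) (P : α → Prop) :
    ind (∀ a ∈ s, P a) = ∏ a ∈ s, ind (P a) := by
  classical
  induction s using Finset.induction_on with
  | empty => simp [ind]
  | insert a s ha ih => rw [Finset.prod_insert ha, ← ih, ← ind_and, Finset.forall_mem_insert]

end Indicator

section Expect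

variable {ι κ : Type*} [Fintype ι] [DecidableEq ι] [Fintype κ]

/-- The expectation of `f ω` when the coordinates of `ω : ι → κ` are independent, each distributed
according to the weights `m`. -/
def expect (m : κ → ℝ) (f : (ι → κ) → ℝ) : ℝ := ∑ ω, (∏ i, m (ω i)) * f ω

/-- The probability of an event under the product law with weights `m`. -/
def prb (m : κ → ℝ) (E : (ι → κ) → Prop) : ℝ := expect m fun ω => ind (E ω)

variable {m : κ → ℝ}

theorem expect_const (hm : ∑ k, m k = 1) (c : ℝ) : expect (ι := ι) m (fun _ => c) = c := by
  have h := (Finset.prod_univ_sum (fun _ : ι => (Finset.univ : Finset κ)) (fun _ k => m k)).symm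
  rw [Fintype.piFinset_univ] at h
  simp only [expect, ← Finset.sum_mul]
  rw [h]; simp [hm]

theorem expect_mono (hm0 : ∀ k, 0 ≤ m k) {f g : (ι → κ) → ℝ} (h : ∀ ω, f ω ≤ g ω) :
    expect m f ≤ expect m g :=
  Finset.sum_le_sum fun ω _ =>
    mul_le_mul_of_nonneg_left (h ω) (Finset.prod_nonneg fun _ _ => hm0 _)

theorem expect_nonneg (hm0 : ∀ k, 0 ≤ m k) {f : (ι → κ) → ℝ} (h : ∀ ω, 0 ≤ f ω) :
    0 ≤ expect m f :=
  Finset.sum_nonneg fun ω _ => mul_nonneg (Finset.prod_nonneg fun _ _ => hm0 _) (h ω)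

theorem expect_add (f g : (ι → κ) → ℝ) :
    expect m (fun ω => f ω + g ω) = expect m f + expect m g := by
  simp [expect, mul_add, Finset.sum_add_distrib]

theorem expect_sub (f g : (ι → κ) → ℝ) :
    expect m (fun ω => f ω - g ω) = expect m f - expect m g := by
  simp [expect, mul_sub, Finset.sum_sub_distrib]

theorem expect_const_mul (c : ℝ) (f : (ι → κ) → ℝ) :
    expect m (fun ω => c * f ω) = c * expect m f := by
  simp only [expect, Finset.mul_sum]
  exact Finset.sum_congr rfl fun ω _ => by ring

theorem expect_sum {α : Type*} (s : Finset α) (f : α → (ι → κ) → ℝ) :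
    expect m (fun ω => ∑ a ∈ s, f a ω) = ∑ a ∈ s, expect m (f a) := by
  simp only [expect, Finset.mul_sum]
  exact Finset.sum_comm

theorem prb_nonneg (hm0 : ∀ k, 0 ≤ m k) (E : (ι → κ) → Prop) : 0 ≤ prb m E :=
  expect_nonneg hm0 fun _ => ind_nonneg _

theorem prb_mono (hm0 : ∀ k, 0 ≤ m k) {E F : (ι → κ) → Prop} (h : ∀ ω, E ω → F ω) :
    prb m E ≤ prb m F :=
  expect_mono hm0 fun ω => ind_mono (h ω)

theorem prb_or_le (hm0 : ∀ k, 0 ≤ m k) (E F : (ι → κ) → Prop) :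
    prb m (fun ω => E ω ∨ F ω) ≤ prb m E + prb m F := by
  unfold prb
  rw [← expect_add]
  refine expect_mono hm0 fun ω => ?_
  by_cases hE : E ω <;> by_cases hF : F ω <;> simp [ind, hE, hF]

theorem prb_not (hm : ∑ k, m k = 1) (E : (ι → κ) → Prop) :
    prb m (fun ω => ¬ E ω) = 1 - prb m E := by
  simp only [prb, ind_not]
  rw [expect_sub, expect_const hm]

/-- Markov's inequality, in the form of a union bound. -/
theorem prb_le_expect (hm0 : ∀ k, 0 ≤ m k) {E : (ι → κ) → Prop} {f : (ι → κ) → ℝ}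
    (h0 : ∀ ω, 0 ≤ f ω) (h : ∀ ω, E ω → 1 ≤ f ω) : prb m E ≤ expect m f :=
  expect_mono hm0 fun ω => by
    by_cases hE : E ω
    · simpa [ind, hE] using h ω hE
    · simpa [ind, hE] using h0 ω

/-- Functions of disjoint sets of coordinates are independent. The proof takes two independent
copies `ω`, `ω'` of the configuration and exchanges their coordinates outside `S`. -/
theorem expect_mul (hm : ∑ k, m k = 1) {f g : (ι → κ) → ℝ} {S T : Set ι}
    (hf : DependsOn f S) (hg : DependsOn g T) (hST : Disjoint S T) :
    expect m (fun ω => f ω * g ω) = expect m f * expect m g := by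
  classical
  set W : (ι → κ) → ℝ := fun ω => ∏ i, m (ω i) with hW
  let φ : (ι → κ) × (ι → κ) → (ι → κ) × (ι → κ) := fun q =>
    (S.piecewise q.1 q.2, S.piecewise q.2 q.1)
  have hφ : Function.Involutive φ := by
    rintro ⟨ω, ω'⟩
    simp only [φ, Prod.mk.injEq]
    constructor <;> ext i <;> by_cases hi : i ∈ S <;> simp [hi]
  have hw : ∀ q : (ι → κ) × (ι → κ), W (φ q).1 * W (φ q).2 = W q.1 * W q.2 := by
    rintro ⟨ω, ω'⟩
    simp only [hW, φ, ← Finset.prod_mul_distrib]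
    refine Finset.prod_congr rfl fun i _ => ?_
    by_cases hi : i ∈ S <;> simp [hi, mul_comm]
  have h1 : expect m f * expect m g
      = ∑ q : (ι → κ) × (ι → κ), W q.1 * W q.2 * (f q.1 * g q.2) := by
    simp only [expect, Finset.sum_mul_sum, Fintype.sum_prod_type]
    refine Finset.sum_congr rfl fun ω _ => Finset.sum_congr rfl fun ω' _ => ?_
    simp only [hW]; ring
  have h2 : expect m (fun ω => f ω * g ω)
      = ∑ q : (ι → κ) × (ι → κ), W q.1 * W q.2 * (f q.1 * g q.1) := by
    have h3 := expect_const (ι := ι) hm 1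
    simp only [expect, mul_one] at h3
    simp only [expect, Fintype.sum_prod_type]
    refine Finset.sum_congr rfl fun ω _ => ?_
    have : ∀ ω' : ι → κ, W ω * W ω' * (f ω * g ω) = W ω * (f ω * g ω) * W ω' := fun _ => by ring
    simp only [this, ← Finset.mul_sum]
    simp only [hW, h3, mul_one]
  rw [h1, h2]
  refine (Fintype.sum_equiv hφ.toPerm _ _ fun q => ?_)
  simp only [Function.Involutive.coe_toPerm]
  rw [hw]
  congr 1
  have ha : f (φ q).1 = f q.1 := hf fun i hi => by simp [φ, hi]
  have hb : g (φ q).2 = g q.1 := hg fun i hi => by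
    have : i ∉ S := fun h => (Set.disjoint_left.1 hST h hi)
    simp [φ, this]
  rw [ha, hb]

theorem expect_prod (hm : ∑ k, m k = 1) {α : Type*} (s : Finset α)
    (f : α → (ι → κ) → ℝ) (S : α → Set ι) (hf : ∀ a ∈ s, DependsOn (f a) (S a))
    (hS : ∀ a ∈ s, ∀ b ∈ s, a ≠ b → Disjoint (S a) (S b)) :
    expect m (fun ω => ∏ a ∈ s, f a ω) = ∏ a ∈ s, expect m (f a) := by
  classical
  induction s using Finset.induction_on with
  | empty => simpa using expect_const (ι := ι) hm 1
  | insert a s ha ih =>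
    simp only [Finset.prod_insert ha]
    rw [expect_mul (S := S a) (T := ⋃ b ∈ s, S b) hm (hf a (mem_insert_self _ _)),
      ih (fun b hb => hf b (mem_insert_of_mem hb))
        (fun b hb c hc => hS b (mem_insert_of_mem hb) c (mem_insert_of_mem hc))]
    · intro x y hxy
      refine Finset.prod_congr rfl fun b hb => hf b (mem_insert_of_mem hb) fun i hi => ?_
      exact hxy i (Set.mem_biUnion (Finset.mem_coe.2 hb) hi)
    · refine Set.disjoint_iUnion₂_right.2 fun b hb => hS a (mem_insert_self _ _) b
        (mem_insert_of_mem hb) ?_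
      rintro rfl; exact ha hb

open Classical in
theorem expect_coord (hm : ∑ k, m k = 1) (i : ι) (φ : κ → ℝ) :
    expect m (fun ω : ι → κ => φ (ω i)) = ∑ k, m k * φ k := by
  have h := (Finset.prod_univ_sum (fun _ : ι => (Finset.univ : Finset κ))
    (fun j k => m k * if j = i then φ k else 1)).symm
  rw [Fintype.piFinset_univ] at h
  simp only [Finset.prod_mul_distrib, Finset.prod_ite_eq', Finset.mem_univ, if_true] at h
  rw [expect, h, Finset.prod_eq_single i]
  · simp
  · intro j _ hj; simp [hj, hm]
  · simp

/-- The probability that a label lies in `a`. -/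
def mass (m : κ → ℝ) (a : Set κ) : ℝ := ∑ k, m k * ind (k ∈ a)

theorem mass_nonneg (hm0 : ∀ k, 0 ≤ m k) (a : Set κ) : 0 ≤ mass m a :=
  Finset.sum_nonneg fun k _ => mul_nonneg (hm0 k) (ind_nonneg _)

theorem mass_compl (hm : ∑ k, m k = 1) (a : Set κ) : mass m aᶜ = 1 - mass m a := by
  rw [← hm, mass, mass, ← Finset.sum_sub_distrib]
  refine Finset.sum_congr rfl fun k _ => ?_
  rw [Set.mem_compl_iff, ind_not]; ring

theorem mass_le_one (hm0 : ∀ k, 0 ≤ m k) (hm : ∑ k, m k = 1) (a : Set κ) : mass m a ≤ 1 := by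
  have := mass_nonneg hm0 aᶜ
  rw [mass_compl hm] at this; linarith

theorem prb_mem (hm : ∑ k, m k = 1) (i : ι) (a : Set κ) :
    prb m (fun ω : ι → κ => ω i ∈ a) = mass m a :=
  expect_coord hm i fun k => ind (k ∈ a)

/-- The probability that all coordinates in `S` lie in `a`. -/
theorem prb_forall_mem (hm : ∑ k, m k = 1) (S : Finset ι) (a : Set κ) :
    prb m (fun ω : ι → κ => ∀ i ∈ S, ω i ∈ a) = mass m a ^ #S := by
  have h := fun i (_ : i ∈ S) => prb_mem (ι := ι) hm i a
  simp only [prb, ind_forall] at h ⊢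
  rw [expect_prod hm S (fun i (ω : ι → κ) => ind (ω i ∈ a)) (fun i => {i})]
  · rw [Finset.prod_congr rfl h, Finset.prod_const]
  · intro i _ x y h; simp only [h i rfl]
  · intro i _ j _ hij; simpa using hij

end Expect

/-! ### The Lovász Local Lemma -/

section LocalLemma

variable {ι κ α : Type*} [Fintype ι] [DecidableEq ι] [Fintype κ] [DecidableEq α]

/-- Independence of an event `E` from another event `F`. -/
theorem prb_and {m : κ → ℝ} (hm : ∑ k, m k = 1) {E F : (ι → κ) → Prop} {S T : Set ι}
    (hE : DependsOn E S) (hF : DependsOn F T) (hST : Disjoint S T) :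
    prb m (fun ω => E ω ∧ F ω) = prb m E * prb m F := by
  simp only [prb, ind_and]
  refine expect_mul (S := S) (T := T) hm ?_ ?_ hST
  · intro x y h; simp only [hE h]
  · intro x y h; simp only [hF h]

theorem prb_not_and {m : κ → ℝ} (E F : (ι → κ) → Prop) :
    prb m (fun ω => ¬ E ω ∧ F ω) = prb m F - prb m (fun ω => E ω ∧ F ω) := by
  simp only [prb, ind_and, ind_not]
  rw [← expect_sub]
  congr 1; ext ω; ring

theorem prb_avoid_insert {m : κ → ℝ} (bad : α → (ι → κ) → Prop) (a : α) (T : Finset α) :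
    prb m (fun ω => ∀ b ∈ insert a T, ¬ bad b ω)
      = prb m (fun ω => ∀ b ∈ T, ¬ bad b ω)
        - prb m (fun ω => bad a ω ∧ ∀ b ∈ T, ¬ bad b ω) := by
  simp only [Finset.forall_mem_insert]
  exact prb_not_and _ _

/-- The asymmetric Lovász Local Lemma in the variable setting: the event `bad a` depends only on
the coordinates in `vbl a`, and two events are adjacent if these sets of coordinates meet. -/
theorem exists_forall_not_bad {m : κ → ℝ} (hm0 : ∀ k, 0 ≤ m k) (hm : ∑ k, m k = 1)
    (S : Finset α) (bad : α → (ι → κ) → Prop) (vbl : α → Set ι) (Γ : α → Finset α) (x : α → ℝ)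
    (hdep : ∀ a ∈ S, DependsOn (bad a) (vbl a))
    (hΓ : ∀ a ∈ S, ∀ b ∈ S, b ≠ a → b ∉ Γ a → Disjoint (vbl a) (vbl b))
    (hx0 : ∀ a, 0 ≤ x a) (hx1 : ∀ a, x a < 1)
    (h : ∀ a ∈ S, prb m (bad a) ≤ x a * ∏ b ∈ Γ a, (1 - x b)) :
    ∃ ω, ∀ a ∈ S, ¬ bad a ω := by
  let Av : Finset α → ℝ := fun T => prb m (fun ω => ∀ b ∈ T, ¬ bad b ω)
  let C : Finset α → Prop := fun T => ∀ a ∈ S, a ∉ T →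
    prb m (fun ω => bad a ω ∧ ∀ b ∈ T, ¬ bad b ω) ≤ x a * Av T
  -- adding the events of `W` one by one to the avoided events of `R`
  have key : ∀ T : Finset α, T ⊆ S → (∀ U, U ⊂ T → C U) → ∀ W R : Finset α, W ∪ R ⊆ T →
      Disjoint W R → (∏ b ∈ W, (1 - x b)) * Av R ≤ Av (W ∪ R) := by
    intro T hTS hT W R
    induction W using Finset.induction_on with
    | empty => intros; simp
    | insert b W hb ih =>
      intro hsub hdis
      rw [Finset.disjoint_insert_left] at hdis
      rw [Finset.insert_union] at hsub ⊢
      have hbn : b ∉ W ∪ R := by simp [hb, hdis.1]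
      have hC := hT (W ∪ R) (lt_of_lt_of_le (Finset.ssubset_insert hbn) hsub) b
        (hTS (hsub (mem_insert_self _ _))) hbn
      have h1 := ih ((Finset.subset_insert _ _).trans hsub) hdis.2
      have h2 : Av (insert b (W ∪ R)) = _ := prb_avoid_insert bad b (W ∪ R)
      rw [h2, Finset.prod_insert hb, mul_assoc]
      have h3 := mul_le_mul_of_nonneg_left h1 (sub_nonneg.2 (hx1 b).le)
      have h4 : (1 - x b) * Av (W ∪ R) = Av (W ∪ R) - x b * Av (W ∪ R) := by ring
      change _ ≤ Av (W ∪ R) - _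
      linarith
  have main : ∀ T : Finset α, T ⊆ S → C T := by
    intro T
    induction T using Finset.strongInduction with
    | H T ih =>
      intro hTS a ha haT
      have hT : ∀ U, U ⊂ T → C U := fun U hU => ih U hU (hU.subset.trans hTS)
      set T1 := T.filter (· ∈ Γ a)
      set T2 := T.filter (· ∉ Γ a)
      have hun : T1 ∪ T2 = T := Finset.filter_union_filter_not_eq _ _
      have hd : Disjoint T1 T2 := Finset.disjoint_filter_filter_not _ _ _
      have h1 : prb m (fun ω => bad a ω ∧ ∀ b ∈ T, ¬ bad b ω)
          ≤ prb m (fun ω => bad a ω ∧ ∀ b ∈ T2, ¬ bad b ω) :=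
        prb_mono hm0 fun ω hω => ⟨hω.1, fun b hb => hω.2 b (Finset.mem_of_mem_filter b hb)⟩
      have h2 : prb m (fun ω => bad a ω ∧ ∀ b ∈ T2, ¬ bad b ω) = prb m (bad a) * Av T2 := by
        refine prb_and (S := vbl a) (T := ⋃ b ∈ T2, vbl b) hm (hdep a ha) ?_ ?_
        · intro ω ω' hω
          refine propext (forall₂_congr fun b hb => ?_)
          have := hdep b (hTS (Finset.mem_of_mem_filter b hb))
            (fun i hi => hω i (Set.mem_biUnion (Finset.mem_coe.2 hb) hi))
          rw [this]
        · refine Set.disjoint_iUnion₂_right.2 fun b hb => ?_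
          have hb' := Finset.mem_filter.1 hb
          exact hΓ a ha b (hTS hb'.1) (fun hba => haT (hba ▸ hb'.1)) hb'.2
      have h3 := key T hTS hT T1 T2 hun.le hd
      rw [hun] at h3
      have hAv : 0 ≤ Av T2 := prb_nonneg hm0 _
      have hsub : T1 ⊆ Γ a := fun b hb => (Finset.mem_filter.1 hb).2
      have h4 : ∏ b ∈ Γ a, (1 - x b) ≤ ∏ b ∈ T1, (1 - x b) := by
        rw [← Finset.prod_sdiff hsub]
        refine mul_le_of_le_one_left (Finset.prod_nonneg fun b _ => sub_nonneg.2 (hx1 b).le) ?_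
        exact Finset.prod_le_one (fun b _ => sub_nonneg.2 (hx1 b).le)
          fun b _ => by linarith [hx0 b]
      calc _ ≤ prb m (bad a) * Av T2 := h1.trans h2.le
        _ ≤ (x a * ∏ b ∈ T1, (1 - x b)) * Av T2 :=
          mul_le_mul_of_nonneg_right
            ((h a ha).trans (mul_le_mul_of_nonneg_left h4 (hx0 a))) hAv
        _ = x a * ((∏ b ∈ T1, (1 - x b)) * Av T2) := by ring
        _ ≤ _ := mul_le_mul_of_nonneg_left h3 (hx0 a)
  have hfin := key S Subset.rfl (fun U hU => main U hU.subset) S ∅ (by simp) (by simp)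
  have h0 : Av ∅ = 1 := by simpa [Av, prb, ind] using expect_const (ι := ι) hm 1
  rw [h0, mul_one, Finset.union_empty] at hfin
  have hpos : 0 < ∏ b ∈ S, (1 - x b) := Finset.prod_pos fun b _ => sub_pos.2 (hx1 b)
  by_contra hcon
  push Not at hcon
  have : Av S = 0 := by
    have hz : ∀ ω : ι → κ, ¬ ∀ b ∈ S, ¬ bad b ω := fun ω hω => by
      obtain ⟨a, ha, hb⟩ := hcon ω; exact hω a ha hb
    simp [Av, prb, hz, expect, ind]
  linarith

end LocalLemma

/-! ### Diameter two, rainbow connection number two and the deterministic condition -/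

section Basic

variable {V : Type*}

theorem propD_iff {G : SimpleGraph V} :
    PropD G ↔ ∀ u v, u ≠ v → ¬ G.Adj u v → ∃ w, G.Adj u w ∧ G.Adj v w := by
  rw [PropD, SimpleGraph.ediam_le_iff]
  constructor
  · intro h u v huv hadj
    have h2 := h u v
    obtain ⟨p, hp⟩ := SimpleGraph.exists_walk_of_edist_ne_top
      (ne_top_of_le_ne_top (by simp) h2)
    rw [← hp] at h2
    have h3 : p.length ≤ 2 := by exact_mod_cast h2
    match p, h3 with
    | .nil, _ => exact absurd rfl huv
    | .cons h .nil, _ => exact absurd h hadj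
    | .cons (v := w) h (.cons h' .nil), _ => exact ⟨w, h, h'.symm⟩
  · intro h u v
    by_cases huv : u = v
    · subst huv; simp
    by_cases hadj : G.Adj u v
    · exact (SimpleGraph.Walk.edist_le (.cons hadj .nil)).trans (by simp)
    · obtain ⟨w, h1, h2⟩ := h u v huv hadj
      exact (SimpleGraph.Walk.edist_le (.cons h1 (.cons h2.symm .nil))).trans (by simp)

theorem PropD.mono {G H : SimpleGraph V} (hGH : G ≤ H) (hG : PropD G) : PropD H := by
  rw [propD_iff] at *
  intro u v huv hadj
  obtain ⟨w, h1, h2⟩ := hG u v huv fun h => hadj (hGH h)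
  exact ⟨w, hGH h1, hGH h2⟩

theorem PropR.propD {G : SimpleGraph V} (hG : PropR G) : PropD G := by
  have h : rc G < 3 := lt_of_le_of_lt hG (by norm_num)
  rw [rc, iInf_lt_iff] at h
  obtain ⟨k, hk⟩ := h
  rw [iInf_lt_iff] at hk
  obtain ⟨⟨C, hC⟩, hk3⟩ := hk
  have hk2 : k ≤ 2 := by
    have : k < 3 := by exact_mod_cast hk3
    omega
  rw [PropD, SimpleGraph.ediam_le_iff]
  intro u v
  obtain ⟨p, -, hp⟩ := hC u v
  have hlen := hp.length_le_card
  simp only [List.length_map, List.length_attach, SimpleGraph.Walk.length_edges,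
    Fintype.card_fin] at hlen
  exact (SimpleGraph.Walk.edist_le p).trans (by exact_mod_cast hlen.trans hk2)

/-- Two colours suffice if every pair of distinct non-adjacent vertices is joined by a path of
length two in two different colours. -/
theorem propR_of_colouring {G : SimpleGraph V} (c : Sym2 V → Fin 2)
    (hc : ∀ u v, u ≠ v → ¬ G.Adj u v → ∃ w, G.Adj u w ∧ G.Adj v w ∧ c s(u, w) ≠ c s(v, w)) :
    PropR G := by
  refine iInf₂_le (2 : ℕ) ⟨fun e => c e.1, fun u v => ?_⟩
  have hmap : ∀ p : G.Walk u v,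
      (p.edges.attach.map fun e => c e.1) = p.edges.map c := fun p => by simp
  by_cases huv : u = v
  · subst huv
    exact ⟨.nil, by simp [IsRainbowPath]⟩
  by_cases hadj : G.Adj u v
  · refine ⟨.cons hadj .nil, by simp [huv], ?_⟩
    rw [hmap]; simp
  · obtain ⟨w, h1, h2, h3⟩ := hc u v huv hadj
    refine ⟨.cons h1 (.cons h2.symm .nil), by simp [huv, h1.ne, h2.ne'], ?_⟩
    rw [hmap]
    simpa [Sym2.eq_swap (a := w)] using h3

end Basic

section Deterministic

variable {V : Type*} [Fintype V]

open Classical in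
/-- The common neighbours of the vertices in `f`. -/
def commonNbrs (G : SimpleGraph V) (f : Finset V) : Finset V :=
  Finset.univ.filter fun w => ∀ v ∈ f, G.Adj v w

/-- The codegree of a set `f` of vertices: the number of its common neighbours. -/
def codeg (G : SimpleGraph V) (f : Finset V) : ℕ := #(commonNbrs G f)

theorem mem_commonNbrs {G : SimpleGraph V} {f : Finset V} {w : V} :
    w ∈ commonNbrs G f ↔ ∀ v ∈ f, G.Adj v w := by simp [commonNbrs]

theorem codeg_mono {G H : SimpleGraph V} (h : G ≤ H) (f : Finset V) : codeg G f ≤ codeg H f :=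
  Finset.card_le_card fun w hw => by
    rw [mem_commonNbrs] at *; exact fun v hv => h (hw v hv)

/-- A pair of vertices of bounded codegree. The bound is large enough for the Local Lemma to allow
a pair of larger codegree to depend on four pairs of small codegree. -/
structure IsLow (G : SimpleGraph V) (f : Finset V) : Prop where
  card : #f = 2
  codeg_le : codeg G f ≤ 30

theorem IsLow.anti {G H : SimpleGraph V} (h : G ≤ H) {f : Finset V} (hf : IsLow H f) :
    IsLow G f := ⟨hf.card, (codeg_mono h f).trans hf.codeg_le⟩

variable [DecidableEq V]

/-- The probability that a uniformly random `2`-colouring makes all paths of length two between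
`u` and `v` monochromatic. -/
theorem prb_monochromatic {u v : V} (huv : u ≠ v) (C : Finset V) (hu : u ∉ C) (hv : v ∉ C) :
    prb (fun _ : Fin 2 => (1 / 2 : ℝ)) (fun c : Sym2 V → Fin 2 =>
      ∀ w ∈ C, c s(u, w) = c s(v, w)) = (1 / 2) ^ #C := by
  set m := (fun _ : Fin 2 => (1 / 2 : ℝ)) with hm
  have hsum : ∑ k, m k = 1 := by simp [hm]
  simp only [prb, ind_forall]
  rw [expect_prod hsum C (fun w (c : Sym2 V → Fin 2) => ind (c s(u, w) = c s(v, w)))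
    (fun w => {s(u, w), s(v, w)})]
  · rw [← Finset.prod_const]
    refine Finset.prod_congr rfl fun w hw => ?_
    have hwu : u ≠ w := fun h => hu (h ▸ hw)
    have hne : s(u, w) ≠ s(v, w) := by simp [huv, hwu]
    have h2 : (fun c : Sym2 V → Fin 2 => ind (c s(u, w) = c s(v, w)))
        = fun c => ∑ k : Fin 2, ind (c s(u, w) = k) * ind (c s(v, w) = k) := by
      ext c; simp [ind, eq_comm]
    rw [h2, expect_sum]
    have h3 : ∀ k : Fin 2, expect m (fun c : Sym2 V → Fin 2 =>
        ind (c s(u, w) = k) * ind (c s(v, w) = k)) = 1 / 4 := fun k => by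
      rw [expect_mul (S := {s(u, w)}) (T := {s(v, w)}) hsum,
        expect_coord hsum _ (fun j => ind (j = k)), expect_coord hsum _ (fun j => ind (j = k))]
      · simp [hm, ind]; norm_num
      · intro x y h; simp [h _ rfl]
      · intro x y h; simp [h _ rfl]
      · simpa using hne
    simp only [h3]; norm_num
  · intro w _ x y h
    simp [h s(u, w) (by simp), h s(v, w) (by simp)]
  · intro w hw w' hw' hww'
    have : ∀ x ∈ C, x ≠ u ∧ x ≠ v := fun x hx => ⟨fun h => hu (h ▸ hx), fun h => hv (h ▸ hx)⟩
    rw [Set.disjoint_left]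
    rintro e (rfl | rfl) <;> simp [hww', huv, huv.symm, this w hw,
      (this w' hw').1.symm, (this w' hw').2.symm]

open Classical in
/-- The deterministic condition under which every graph `G` of diameter at most two with
`G₁ ≤ G ≤ G₂` has rainbow connection number at most two. By `sum_le`, the pairs `{z, x}` which can
have a path of length two through the edge `zy` have small total weight, where the weight
`(3 / 5) ^ codeg` is slightly larger than the probability `(1 / 2) ^ codeg` that a random
`2`-colouring fails on the pair. The truncation `max 31` makes the weights of the pairs of small
codegree negligible and keeps the condition monotone in `G₁`, which summing over the other pairs
only would not. The remaining conditions separate the pairs of small codegree from each other. -/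
structure WellSpread (G₁ G₂ : SimpleGraph V) : Prop where
  sum_le : ∀ z y, z ≠ y → ∑ x ∈ Finset.univ.filter (fun x => G₂.Adj y x ∧ x ≠ z),
    (3 / 5 : ℝ) ^ max 31 (codeg G₁ {z, x}) ≤ 1 / 1000
  eq_of_low : ∀ f f', IsLow G₁ f → IsLow G₁ f' → ¬ Disjoint f f' → f = f'
  not_adj : ∀ f f', IsLow G₁ f → IsLow G₁ f' → Disjoint f f' →
    ∀ a ∈ f, ∀ b ∈ f', ¬ G₂.Adj a b
  not_nbrs : ∀ u f f', IsLow G₁ f → IsLow G₁ f' → Disjoint f f' →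
    ¬ ∀ a ∈ f ∪ f', G₂.Adj u a

theorem WellSpread.mono {G₁ G₂ H₁ H₂ : SimpleGraph V} (h : WellSpread G₁ G₂) (h₁ : G₁ ≤ H₁)
    (h₂ : H₂ ≤ G₂) : WellSpread H₁ H₂ where
  sum_le z y hzy := by
    refine le_trans ?_ (h.sum_le z y hzy)
    refine (Finset.sum_le_sum fun x _ => ?_).trans
      (Finset.sum_le_sum_of_subset_of_nonneg (fun x hx => ?_) fun _ _ _ => by positivity)
    · exact pow_le_pow_of_le_one (by norm_num) (by norm_num)
        (max_le_max le_rfl (codeg_mono h₁ _))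
    · simp only [Finset.mem_filter, Finset.mem_univ, true_and] at hx ⊢
      exact ⟨h₂ hx.1, hx.2⟩
  eq_of_low f f' hf hf' := h.eq_of_low f f' (hf.anti h₁) (hf'.anti h₁)
  not_adj f f' hf hf' hd a ha b hb hab :=
    h.not_adj f f' (hf.anti h₁) (hf'.anti h₁) hd a ha b hb (h₂ hab)
  not_nbrs u f f' hf hf' hd hu :=
    h.not_nbrs u f f' (hf.anti h₁) (hf'.anti h₁) hd fun a ha => h₂ (hu a ha)

end Deterministic

/-! ### Rainbow colourings from the Local Lemma -/

section LocalLemmaApplication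

variable {V : Type*} [Fintype V]

/-- The edges on the paths of length two between the vertices of the pair `f`. -/
def pathEdges (G : SimpleGraph V) (f : Finset V) : Set (Sym2 V) :=
  {e | ∃ a ∈ f, ∃ w ∈ commonNbrs G f, e = s(a, w)}

/-- The colouring `c` fails on `f` if it does not distinguish the edges from the vertices of `f`
to any of their common neighbours. -/
def Fails (G : SimpleGraph V) (f : Finset V) (c : Sym2 V → Fin 2) : Prop :=
  ∀ w ∈ commonNbrs G f, ∀ a ∈ f, ∀ b ∈ f, c s(a, w) = c s(b, w)

theorem dependsOn_fails (G : SimpleGraph V) (f : Finset V) :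
    DependsOn (Fails G f) (pathEdges G f) := by
  intro c c' h
  refine propext (forall₂_congr fun w hw => forall₂_congr fun a ha => forall₂_congr fun b hb => ?_)
  rw [h s(a, w) ⟨a, ha, w, hw, rfl⟩, h s(b, w) ⟨b, hb, w, hw, rfl⟩]

theorem notMem_of_mem_commonNbrs {G : SimpleGraph V} {f : Finset V} {w : V}
    (hw : w ∈ commonNbrs G f) : w ∉ f := fun h => G.loopless.irrefl w (mem_commonNbrs.1 hw w h)

theorem prb_fails [DecidableEq V] {G : SimpleGraph V} {f : Finset V} (hf : #f = 2) :
    prb (fun _ : Fin 2 => (1 / 2 : ℝ)) (Fails G f) = (1 / 2) ^ codeg G f := by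
  classical
  obtain ⟨u, v, huv, rfl⟩ := Finset.card_eq_two.1 hf
  rw [codeg, ← prb_monochromatic huv (commonNbrs G {u, v})
    (fun h => notMem_of_mem_commonNbrs h (by simp)) (fun h => notMem_of_mem_commonNbrs h (by simp))]
  congr 1; ext c
  refine forall₂_congr fun w _ => ?_
  simp only [Finset.mem_insert, Finset.mem_singleton, forall_eq_or_imp, forall_eq]
  tauto

/-- The two ways in which a path of length two between the vertices of `f'` can share an edge
`aw` with a path between the vertices of `f`, where `a ∈ f`. -/
theorem exists_of_not_disjoint_pathEdges {G : SimpleGraph V} {f f' : Finset V}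
    (h : ¬ Disjoint (pathEdges G f) (pathEdges G f')) :
    ∃ a ∈ f, ∃ w ∈ commonNbrs G f, (a ∈ f' ∧ ∀ b ∈ f', G.Adj w b) ∨
      (w ∈ f' ∧ ∀ b ∈ f', G.Adj a b) := by
  rw [Set.not_disjoint_iff] at h
  obtain ⟨e, ⟨a, ha, w, hw, rfl⟩, ⟨b, hb, w', hw', he⟩⟩ := h
  refine ⟨a, ha, w, hw, ?_⟩
  rw [mem_commonNbrs] at hw'
  rcases Sym2.eq_iff.1 he with ⟨rfl, rfl⟩ | ⟨rfl, rfl⟩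
  · exact Or.inl ⟨hb, fun b hb => (hw' b hb).symm⟩
  · exact Or.inr ⟨hb, fun b hb => (hw' b hb).symm⟩

theorem exp_neg_two_mul_le {x : ℝ} (h0 : 0 ≤ x) (h1 : x ≤ 1 / 2) :
    Real.exp (-(2 * x)) ≤ 1 - x := by
  rw [Real.exp_neg]
  have h2 := Real.add_one_le_exp (2 * x)
  rw [inv_le_comm₀ (Real.exp_pos _) (by linarith)]
  refine le_trans ?_ h2
  rw [inv_le_iff_one_le_mul₀ (by linarith)]
  nlinarith

theorem sum_le_sum_of_forall_exists {α β : Type*} [DecidableEq β] (s : Finset α) (t : Finset β)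
    (g : α → β) (φ : β → ℝ) (h0 : ∀ b, 0 ≤ φ b) (h : ∀ b ∈ t, ∃ a ∈ s, g a = b) :
    ∑ b ∈ t, φ b ≤ ∑ a ∈ s, φ (g a) := by
  have h1 : ∑ b ∈ t, ∑ a ∈ s with g a = b, φ (g a) ≤ ∑ a ∈ s, φ (g a) := by
    rw [Finset.sum_fiberwise_eq_sum_filter]
    exact Finset.sum_le_sum_of_subset_of_nonneg (Finset.filter_subset _ _) fun _ _ _ => h0 _
  refine le_trans (Finset.sum_le_sum fun b hb => ?_) h1
  obtain ⟨a, ha, rfl⟩ := h b hb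
  exact Finset.single_le_sum (f := fun a' => φ (g a')) (fun _ _ => h0 _)
    (Finset.mem_filter.2 ⟨ha, rfl⟩)

theorem exists_pair_of_mem {W : Type*} [DecidableEq W] {f : Finset W} (hf : #f = 2)
    {a : W} (ha : a ∈ f) :
    ∃ x, x ≠ a ∧ f = {a, x} := by
  obtain ⟨u, v, huv, rfl⟩ := Finset.card_eq_two.1 hf
  rcases Finset.mem_insert.1 ha with rfl | h
  · exact ⟨v, huv.symm, rfl⟩
  · rw [Finset.mem_singleton] at h; subst h
    exact ⟨u, huv, Finset.pair_comm _ _⟩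

variable [DecidableEq V]

open Classical in
/-- The pairs other than `f` whose failure is not independent of that of `f`. -/
def depPairs (G : SimpleGraph V) (S : Finset (Finset V)) (f : Finset V) : Finset (Finset V) :=
  S.filter fun f' => f' ≠ f ∧ ¬ Disjoint (pathEdges G f) (pathEdges G f')

variable {G₁ G₂ G : SimpleGraph V}

/-- The pairs of large codegree that depend on `f` have small total weight. -/
theorem sum_depPairs_high_le (h : WellSpread G₁ G₂) (h2 : G ≤ G₂)
    {S : Finset (Finset V)} (hS : ∀ f ∈ S, #f = 2) {f : Finset V} (hf : #f = 2) :
    ∑ f' ∈ depPairs G S f, (3 / 5 : ℝ) ^ max 31 (codeg G₁ f') ≤ codeg G f * (4 / 1000) := by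
  classical
  -- a dependent pair is either `{a, x}` with `x` adjacent to `w`,
  -- or `{w, x}` with `x` adjacent to `a`, for some `a ∈ f` and some common neighbour `w`
  let I : Finset (V × V) := (f ×ˢ commonNbrs G f) ∪ (commonNbrs G f ×ˢ f)
  let s : Finset ((_ : V × V) × V) := I.sigma fun q =>
    Finset.univ.filter fun x => G₂.Adj q.2 x ∧ x ≠ q.1
  have h3 := sum_le_sum_of_forall_exists s (depPairs G S f) (fun q => {q.1.1, q.2})
    (fun f' => (3 / 5 : ℝ) ^ max 31 (codeg G₁ f')) (fun _ => by positivity) (by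
      intro f' hf'
      simp only [depPairs, Finset.mem_filter] at hf'
      obtain ⟨a, ha, w, hw, h4 | h4⟩ := exists_of_not_disjoint_pathEdges hf'.2.2
      · obtain ⟨x, hx, rfl⟩ := exists_pair_of_mem (hS _ hf'.1) h4.1
        refine ⟨⟨(a, w), x⟩, ?_, rfl⟩
        simp [s, I, ha, hw, hx, h2 (h4.2 x (by simp))]
      · obtain ⟨x, hx, rfl⟩ := exists_pair_of_mem (hS _ hf'.1) h4.1
        refine ⟨⟨(w, a), x⟩, ?_, rfl⟩
        simp [s, I, ha, hw, hx, h2 (h4.2 x (by simp))])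
  refine h3.trans ?_
  rw [Finset.sum_sigma]
  have h4 : ∀ q ∈ I, q.1 ≠ q.2 := by
    rintro ⟨a, w⟩ hq heq
    simp only [I, Finset.mem_union, Finset.mem_product] at hq heq
    subst heq
    rcases hq with hq | hq
    · exact notMem_of_mem_commonNbrs hq.2 hq.1
    · exact notMem_of_mem_commonNbrs hq.1 hq.2
  refine (Finset.sum_le_sum (g := fun _ => (1 / 1000 : ℝ))
    fun q hq => h.sum_le q.1 q.2 (h4 q hq)).trans ?_
  rw [Finset.sum_const, nsmul_eq_mul]
  have h5 : #I ≤ 4 * codeg G f := by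
    refine (Finset.card_union_le _ _).trans ?_
    simp only [Finset.card_product, hf, codeg]; omega
  have h6 : (#I : ℝ) ≤ 4 * codeg G f := by exact_mod_cast h5
  linarith

/-- A pair of small codegree depends on no other such pair. -/
theorem not_isLow_of_mem_depPairs (h : WellSpread G₁ G₂) (h2 : G ≤ G₂)
    {S : Finset (Finset V)} {f f' : Finset V} (hf : IsLow G₁ f) (hf' : f' ∈ depPairs G S f) :
    ¬ IsLow G₁ f' := by
  intro hlow
  simp only [depPairs, Finset.mem_filter] at hf'
  have hd : Disjoint f f' := by
    by_contra hd
    exact hf'.2.1 (h.eq_of_low f f' hf hlow hd).symm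
  obtain ⟨a, ha, w, hw, h4 | h4⟩ := exists_of_not_disjoint_pathEdges hf'.2.2
  · exact Finset.disjoint_left.1 hd ha h4.1
  · exact h.not_adj f f' hf hlow hd a ha w h4.1 (h2 (h4.2 w h4.1))

open Classical in
/-- At most four pairs of small codegree depend on a given pair. -/
theorem card_depPairs_low_le (h : WellSpread G₁ G₂) (h2 : G ≤ G₂)
    {S : Finset (Finset V)} {f : Finset V} (hf : #f = 2) :
    #((depPairs G S f).filter (IsLow G₁)) ≤ 4 := by
  set L := (depPairs G S f).filter (IsLow G₁)
  have hsub : L ⊆ f.biUnion fun a => L.filter (a ∈ ·) ∪ L.filter fun f' => ∀ b ∈ f', G.Adj a b := by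
    intro f' hf'
    have hf'' := (Finset.mem_filter.1 hf').1
    simp only [depPairs, Finset.mem_filter] at hf''
    obtain ⟨a, ha, w, hw, h4 | h4⟩ := exists_of_not_disjoint_pathEdges hf''.2.2
    · refine Finset.mem_biUnion.2 ⟨a, ha, Finset.mem_union_left _ ?_⟩
      exact Finset.mem_filter.2 ⟨hf', h4.1⟩
    · refine Finset.mem_biUnion.2 ⟨a, ha, Finset.mem_union_right _ ?_⟩
      exact Finset.mem_filter.2 ⟨hf', h4.2⟩
  have hlow : ∀ f' ∈ L, IsLow G₁ f' := fun f' hf' => (Finset.mem_filter.1 hf').2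
  refine (Finset.card_le_card hsub).trans ((Finset.card_biUnion_le_card_mul _ _ 2 ?_).trans ?_)
  · intro a _
    refine (Finset.card_union_le _ _).trans ?_
    have ha1 : #(L.filter (a ∈ ·)) ≤ 1 := Finset.card_le_one.2 fun x hx y hy => by
      rw [Finset.mem_filter] at hx hy
      exact h.eq_of_low x y (hlow x hx.1) (hlow y hy.1)
        (Finset.not_disjoint_iff.2 ⟨a, hx.2, hy.2⟩)
    have ha2 : #(L.filter fun f' => ∀ b ∈ f', G.Adj a b) ≤ 1 :=
      Finset.card_le_one.2 fun x hx y hy => by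
        rw [Finset.mem_filter] at hx hy
        refine h.eq_of_low x y (hlow x hx.1) (hlow y hy.1) fun hd => ?_
        refine h.not_nbrs a x y (hlow x hx.1) (hlow y hy.1) hd fun b hb => ?_
        rcases Finset.mem_union.1 hb with hb | hb
        · exact h2 (hx.2 b hb)
        · exact h2 (hy.2 b hb)
    omega
  · rw [hf]

/-- A graph of diameter at most two between `G₁` and `G₂` has rainbow connection number at most
two: the Local Lemma, with weight `(3 / 5) ^ codeg` for the failure of a pair, produces a
colouring. -/
theorem WellSpread.propR (h : WellSpread G₁ G₂) (h1 : G₁ ≤ G) (h2 : G ≤ G₂) (hG : PropD G) :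
    PropR G := by
  classical
  rw [propD_iff] at hG
  let S : Finset (Finset V) := Finset.univ.filter fun f =>
    #f = 2 ∧ ∀ a ∈ f, ∀ b ∈ f, ¬ G.Adj a b
  have hS2 : ∀ f ∈ S, #f = 2 := fun f hf => (Finset.mem_filter.1 hf).2.1
  have hcodeg : ∀ f ∈ S, 1 ≤ codeg G f := by
    intro f hf
    obtain ⟨u, v, huv, rfl⟩ := Finset.card_eq_two.1 (hS2 f hf)
    obtain ⟨w, hw1, hw2⟩ := hG u v huv
      ((Finset.mem_filter.1 hf).2.2 u (by simp) v (by simp))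
    exact Finset.card_pos.2 ⟨w, mem_commonNbrs.2 (by simp [hw1, hw2])⟩
  let x : Finset V → ℝ := fun f => (3 / 5) ^ max 1 (codeg G f)
  have hx0 : ∀ f, 0 ≤ x f := fun f => by positivity
  have hx1 : ∀ f, x f ≤ 3 / 5 := fun f => by
    have := pow_le_pow_of_le_one (a := (3 / 5 : ℝ)) (by norm_num) (by norm_num)
      (le_max_left 1 (codeg G f))
    simpa [x] using this
  obtain ⟨c, hc⟩ := exists_forall_not_bad (ι := Sym2 V) (κ := Fin 2) (m := fun _ => (1 / 2 : ℝ))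
    (fun _ => by norm_num) (by simp) S (Fails G) (pathEdges G) (depPairs G S) x
    (fun f _ => dependsOn_fails G f)
    (fun f hf f' hf' hne hn => by
      by_contra hd
      exact hn (Finset.mem_filter.2 ⟨hf', hne, hd⟩))
    hx0 (fun f => (hx1 f).trans_lt (by norm_num)) (by
      intro f hf
      have hf2 := hS2 f hf
      rw [prb_fails hf2]
      have hxf : x f = (3 / 5) ^ codeg G f := by simp only [x, max_eq_right (hcodeg f hf)]
      rw [hxf]
      rw [← Finset.prod_filter_mul_prod_filter_not (depPairs G S f) (IsLow G₁)]
      -- the pairs of large codegree cost a factor `124 / 125 ≤ exp (- 2 * (4 / 1000))` for each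
      -- common neighbour, so that `3 / 5 * (124 / 125)` is still larger than `1 / 2`
      have hhigh : (124 / 125 : ℝ) ^ codeg G f
          ≤ ∏ f' ∈ (depPairs G S f).filter (fun f' => ¬ IsLow G₁ f'), (1 - x f') := by
        have hle : ∀ f' ∈ (depPairs G S f).filter (fun f' => ¬ IsLow G₁ f'),
            x f' ≤ (3 / 5 : ℝ) ^ max 31 (codeg G₁ f') := by
          intro f' hf'
          rw [Finset.mem_filter, depPairs, Finset.mem_filter] at hf'
          have h3 : 31 ≤ codeg G₁ f' := by
            by_contra h4
            exact hf'.2 ⟨hS2 f' hf'.1.1, by omega⟩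
          have h4 := codeg_mono h1 f'
          exact pow_le_pow_of_le_one (by norm_num) (by norm_num) (by omega)
        have h3 : ∑ f' ∈ (depPairs G S f).filter (fun f' => ¬ IsLow G₁ f'), x f'
            ≤ codeg G f * (4 / 1000) :=
          (Finset.sum_le_sum hle).trans ((Finset.sum_le_sum_of_subset_of_nonneg
            (Finset.filter_subset _ _) fun _ _ _ => by positivity).trans
            (sum_depPairs_high_le h h2 hS2 hf2))
        calc (124 / 125 : ℝ) ^ codeg G f ≤ Real.exp (-(1 / 125)) ^ codeg G f := by
              gcongr
              have := Real.add_one_le_exp (-(1 / 125 : ℝ))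
              linarith
          _ = Real.exp (-(2 * (codeg G f * (4 / 1000)))) := by
              rw [← Real.exp_nat_mul]; congr 1; ring
          _ ≤ Real.exp (∑ f' ∈ (depPairs G S f).filter (fun f' => ¬ IsLow G₁ f'),
                -(2 * x f')) := by
              rw [Finset.sum_neg_distrib, ← Finset.mul_sum]
              gcongr
          _ = ∏ f' ∈ (depPairs G S f).filter (fun f' => ¬ IsLow G₁ f'),
                Real.exp (-(2 * x f')) := Real.exp_sum _ _
          _ ≤ _ := Finset.prod_le_prod (fun _ _ => (Real.exp_pos _).le) fun f' hf' =>
              exp_neg_two_mul_le (hx0 f') ((hle f' hf').trans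
                ((pow_le_pow_of_le_one (by norm_num) (by norm_num)
                  (le_max_left 31 (codeg G₁ f'))).trans (by norm_num)))
      by_cases hlow : IsLow G₁ f
      · have h3 : (depPairs G S f).filter (IsLow G₁) = ∅ :=
          Finset.filter_eq_empty_iff.2 fun f' hf' =>
            not_isLow_of_mem_depPairs h h2 hlow hf'
        rw [h3, Finset.prod_empty, one_mul]
        calc (1 / 2 : ℝ) ^ codeg G f ≤ (3 / 5 * (124 / 125)) ^ codeg G f := by
              gcongr; norm_num
          _ = (3 / 5) ^ codeg G f * (124 / 125) ^ codeg G f := mul_pow _ _ _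
          _ ≤ _ := by gcongr
      -- at most four pairs of small codegree cost a factor `2 / 5` each, which the gain of
      -- `2 * (3 / 5) * (124 / 125)` for each of at least `31` common neighbours outweighs
      · have hd : 31 ≤ codeg G f := by
          by_contra h4
          exact hlow ⟨hf2, (codeg_mono h1 f).trans (by omega)⟩
        have h3 : (2 / 5 : ℝ) ^ 4 ≤ ∏ f' ∈ (depPairs G S f).filter (IsLow G₁), (1 - x f') := by
          calc (2 / 5 : ℝ) ^ 4 ≤ (2 / 5) ^ #((depPairs G S f).filter (IsLow G₁)) :=
                pow_le_pow_of_le_one (by norm_num) (by norm_num) (card_depPairs_low_le h h2 hf2)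
            _ = ∏ f' ∈ (depPairs G S f).filter (IsLow G₁), (2 / 5 : ℝ) := by
                rw [Finset.prod_const]
            _ ≤ _ := Finset.prod_le_prod (fun _ _ => by norm_num) fun f' _ => by
                linarith [hx1 f']
        have h5 : (1 / 2 : ℝ) ^ codeg G f
            ≤ (3 / 5 * (124 / 125)) ^ codeg G f * (2 / 5) ^ 4 := by
          have h6 : ((5 / 2) ^ 4 : ℝ) ≤ (2 * (3 / 5 * (124 / 125))) ^ codeg G f :=
            le_trans (by norm_num) (pow_le_pow_right₀ (by norm_num) hd)
          have h7 : ((3 / 5 * (124 / 125)) ^ codeg G f : ℝ)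
              = (2 * (3 / 5 * (124 / 125))) ^ codeg G f * (1 / 2) ^ codeg G f := by
            rw [← mul_pow]; congr 1; norm_num
          have h8 : (0 : ℝ) ≤ (1 / 2) ^ codeg G f := by positivity
          rw [h7]
          nlinarith
        calc (1 / 2 : ℝ) ^ codeg G f
            ≤ (3 / 5 * (124 / 125)) ^ codeg G f * (2 / 5) ^ 4 := h5
          _ = (3 / 5) ^ codeg G f * ((2 / 5) ^ 4 * (124 / 125) ^ codeg G f) := by
              rw [mul_pow]; ring
          _ ≤ _ := by
              refine mul_le_mul_of_nonneg_left ?_ (by positivity)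
              exact mul_le_mul h3 hhigh (by positivity) (le_trans (by norm_num) h3))
  refine propR_of_colouring c fun u v huv hadj => ?_
  have hmem : ({u, v} : Finset V) ∈ S := by
    refine Finset.mem_filter.2 ⟨Finset.mem_univ _, Finset.card_pair huv, ?_⟩
    have hadj' : ¬ G.Adj v u := fun h => hadj h.symm
    simp [hadj, hadj']
  have h3 := hc _ hmem
  by_contra hcon
  push Not at hcon
  refine h3 fun w hw a ha b hb => ?_
  rw [mem_commonNbrs] at hw
  have h4 := hcon w (hw u (by simp)) (hw v (by simp))
  simp only [Finset.mem_insert, Finset.mem_singleton] at ha hb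
  rcases ha with rfl | rfl <;> rcases hb with rfl | rfl <;> simp [h4]

end LocalLemmaApplication

/-! ### Codegrees in binomial random graphs -/

section LabelledGraph

variable {V κ : Type*}

/-- The graph formed by the pairs of vertices whose label lies in `a`. If the labels are
independent with weights `m`, this is a binomial random graph with edge probability `mass m a`. -/
def labelGraph (a : Set κ) (ω : Sym2 V → κ) : SimpleGraph V :=
  SimpleGraph.fromEdgeSet {e | ω e ∈ a}

theorem labelGraph_adj {a : Set κ} {ω : Sym2 V → κ} {u v : V} :
    (labelGraph a ω).Adj u v ↔ ω s(u, v) ∈ a ∧ u ≠ v := by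
  simp [labelGraph]

variable {m : κ → ℝ}

variable [Fintype V] [Fintype κ] [DecidableEq V]

/-- The stars between `V₀` and the vertices outside `V₀` are independent of each other and of the
pairs inside `V₀`. -/
theorem expect_star (hm : ∑ k, m k = 1) (V₀ : Finset V) (h : (Sym2 V → κ) → ℝ)
    (g : V → (Sym2 V → κ) → ℝ) (hh : DependsOn h {e | ∀ v ∈ e, v ∈ V₀})
    (hg : ∀ w, DependsOn (g w) {e | ∃ v ∈ V₀, e = s(v, w)}) :
    expect m (fun ω => h ω * ∏ w ∈ V₀ᶜ, g w ω) = expect m h * ∏ w ∈ V₀ᶜ, expect m (g w) := by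
  rw [expect_mul (T := ⋃ w ∈ V₀ᶜ, {e | ∃ v ∈ V₀, e = s(v, w)}) hm hh,
    expect_prod hm _ _ _ fun w _ => hg w]
  · intro w hw w' hw' hne
    rw [Set.disjoint_left]
    rintro e ⟨v, hv, rfl⟩ ⟨v', hv', he⟩
    rcases Sym2.eq_iff.1 he with ⟨-, h2⟩ | ⟨h1, -⟩
    · exact hne h2
    · exact (Finset.mem_compl.1 hw') (h1 ▸ hv)
  · intro x y hxy
    refine Finset.prod_congr rfl fun w hw => hg w fun e he => ?_
    exact hxy e (Set.mem_biUnion (Finset.mem_coe.2 hw) he)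
  · refine Set.disjoint_iUnion₂_right.2 fun w hw => ?_
    rw [Set.disjoint_left]
    rintro e he ⟨v, hv, rfl⟩
    exact (Finset.mem_compl.1 hw) (he w (by simp))

theorem prb_star_mem (hm : ∑ k, m k = 1) (f : Finset V) (w : V) (a : Set κ) :
    prb m (fun ω : Sym2 V → κ => ∀ v ∈ f, ω s(v, w) ∈ a) = mass m a ^ #f := by
  have h := prb_forall_mem hm (f.image fun v => s(v, w)) a
  rw [Finset.card_image_of_injective] at h
  · rw [← h]; congr 1; ext ω; simp
  · intro v v' h
    rcases Sym2.eq_iff.1 h with ⟨h, -⟩ | ⟨h1, h2⟩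
    · exact h
    · exact h1.trans h2

open Classical in
/-- A Bonferroni bound for the number of pairs in `F` with common neighbour `w`. Two distinct
pairs span at least three vertices, which accounts for the cube. -/
theorem expect_prod_star_le (hm0 : ∀ k, 0 ≤ m k) (hm : ∑ k, m k = 1) (F : Finset (Finset V))
    (hF : ∀ f ∈ F, #f = 2) (w : V) (a : Set κ) {s : ℝ} (hs0 : 0 ≤ s) (hs1 : s ≤ 1) :
    expect m (fun ω : Sym2 V → κ => ∏ f ∈ F, if ∀ v ∈ f, ω s(v, w) ∈ a then s else 1)
      ≤ 1 - (1 - s) * (#F * mass m a ^ 2 - #F ^ 2 * mass m a ^ 3) := by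
  set p := mass m a
  have hp0 : 0 ≤ p := mass_nonneg hm0 a
  have hp1 : p ≤ 1 := mass_le_one hm0 hm a
  let Y : Finset V → (Sym2 V → κ) → ℝ := fun f ω => ind (∀ v ∈ f, ω s(v, w) ∈ a)
  have hY : ∀ f, expect m (Y f) = p ^ #f := fun f => prb_star_mem hm f w a
  have hpt : ∀ ω : Sym2 V → κ, (∏ f ∈ F, if ∀ v ∈ f, ω s(v, w) ∈ a then s else 1)
      ≤ 1 - (1 - s) * (∑ f ∈ F, Y f ω - ∑ f ∈ F, ∑ f' ∈ F.erase f, Y (f ∪ f') ω) := by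
    intro ω
    set X := #(F.filter fun f => ∀ v ∈ f, ω s(v, w) ∈ a) with hX
    have h1 : (∏ f ∈ F, if ∀ v ∈ f, ω s(v, w) ∈ a then s else 1) = s ^ X := by
      rw [Finset.prod_ite]; simp [hX]
    have h2 : ∑ f ∈ F, Y f ω = X := by
      rw [hX, Finset.card_filter, Nat.cast_sum]
      refine Finset.sum_congr rfl fun f _ => ?_
      by_cases h : ∀ v ∈ f, ω s(v, w) ∈ a
      · simp only [Y, ind_true h, if_pos h, Nat.cast_one]
      · simp only [Y, ind_false h, if_neg h, Nat.cast_zero]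
    have h3 : ∑ f ∈ F, ∑ f' ∈ F.erase f, Y (f ∪ f') ω = (X:ℝ) ^ 2 - X := by
      have h4 : ∀ f f', Y (f ∪ f') ω = Y f ω * Y f' ω := fun f f' => by
        simp only [Y, Finset.mem_union, or_imp, forall_and, ind_and]
      have h5 : ∀ f ∈ F, ∑ f' ∈ F.erase f, Y (f ∪ f') ω = Y f ω * X - Y f ω := fun f hf => by
        simp only [h4, ← Finset.mul_sum]
        have h6 := Finset.add_sum_erase F (fun f => Y f ω) hf
        rw [h2] at h6
        have h7 : Y f ω * Y f ω = Y f ω := by simp only [Y, ind]; split_ifs <;> simp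
        have h8 : ∑ f' ∈ F.erase f, Y f' ω = X - Y f ω := by linarith
        rw [h8, mul_sub, h7]
      rw [Finset.sum_congr rfl h5, Finset.sum_sub_distrib, ← Finset.sum_mul, h2]; ring
    rw [h1, h2, h3]
    rcases Nat.lt_or_ge X 2 with h | h
    · interval_cases X
      · simp
      · simp
    · have h4 : s ^ X ≤ 1 := pow_le_one₀ hs0 hs1
      have h5 : (2:ℝ) ≤ X := by exact_mod_cast h
      have h6 : (X:ℝ) - (X ^ 2 - X) ≤ 0 := by nlinarith
      nlinarith
  refine (expect_mono hm0 hpt).trans ?_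
  rw [expect_sub, expect_const hm, expect_const_mul, expect_sub, expect_sum, expect_sum]
  have h1 : ∑ f ∈ F, expect m (Y f) = #F * p ^ 2 := by
    rw [Finset.sum_congr rfl fun f hf => by rw [hY f, hF f hf]]; simp
  have h2 : ∑ f ∈ F, expect m (fun ω => ∑ f' ∈ F.erase f, Y (f ∪ f') ω) ≤ #F ^ 2 * p ^ 3 := by
    have h3 : ∀ f ∈ F, expect m (fun ω => ∑ f' ∈ F.erase f, Y (f ∪ f') ω) ≤ #F * p ^ 3 := by
      intro f hf
      rw [expect_sum]
      have h4 : ∀ f' ∈ F.erase f, expect m (Y (f ∪ f')) ≤ p ^ 3 := fun f' hf' => by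
        rw [hY]
        refine pow_le_pow_of_le_one hp0 hp1 ?_
        rw [Finset.mem_erase] at hf'
        by_contra hlt
        have h5 : #(f ∪ f') ≤ #f := by rw [hF f hf]; omega
        have h6 : #(f ∪ f') ≤ #f' := by rw [hF f' hf'.2]; omega
        have h7 := Finset.eq_of_subset_of_card_le Finset.subset_union_left h5
        have h8 := Finset.eq_of_subset_of_card_le Finset.subset_union_right h6
        exact hf'.1 (h8.trans h7.symm)
      refine (Finset.sum_le_sum h4).trans ?_
      rw [Finset.sum_const, nsmul_eq_mul]
      gcongr
      exact Finset.erase_subset _ _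
    refine (Finset.sum_le_sum h3).trans ?_
    rw [Finset.sum_const, nsmul_eq_mul]; apply le_of_eq; ring
  have h3 : 0 ≤ 1 - s := by linarith
  rw [h1]
  have := mul_le_mul_of_nonneg_left h2 h3
  nlinarith

open Classical in
/-- The basic moment bound: the edges in `H` are present in the graph of label set `b`, and each
pair in `F` contributes the factor `s ^ codeg` for the graph of label set `a`. -/
theorem expect_edges_mul_codeg_le (hm0 : ∀ k, 0 ≤ m k) (hm : ∑ k, m k = 1) (V₀ : Finset V)
    (F : Finset (Finset V)) (hF : ∀ f ∈ F, #f = 2 ∧ f ⊆ V₀) (H : Finset (Sym2 V))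
    (hH : ∀ e ∈ H, ∀ v ∈ e, v ∈ V₀) (a b : Set κ) {s : ℝ} (hs0 : 0 ≤ s) (hs1 : s ≤ 1) :
    expect m (fun ω : Sym2 V → κ => ind (∀ e ∈ H, ω e ∈ b) *
        ∏ f ∈ F, s ^ codeg (labelGraph a ω) f)
      ≤ mass m b ^ #H *
        (1 - (1 - s) * (#F * mass m a ^ 2 - #F ^ 2 * mass m a ^ 3)) ^ (Fintype.card V - #V₀) := by
  let g : V → (Sym2 V → κ) → ℝ := fun w ω => ∏ f ∈ F, if ∀ v ∈ f, ω s(v, w) ∈ a then s else 1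
  have h1 : ∀ ω : Sym2 V → κ, ∏ f ∈ F, s ^ codeg (labelGraph a ω) f ≤ ∏ w ∈ V₀ᶜ, g w ω := by
    intro ω
    rw [Finset.prod_comm]
    refine Finset.prod_le_prod (fun _ _ => by positivity) fun f hf => ?_
    rw [Finset.prod_ite]
    simp only [Finset.prod_const, one_pow, mul_one]
    refine pow_le_pow_of_le_one hs0 hs1 (Finset.card_le_card fun w hw => ?_)
    rw [Finset.mem_filter] at hw
    rw [mem_commonNbrs]
    intro v hv
    rw [labelGraph_adj]
    refine ⟨hw.2 v hv, ?_⟩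
    rintro rfl
    exact Finset.mem_compl.1 hw.1 ((hF f hf).2 hv)
  have h2 : ∀ w, 0 ≤ expect m (g w) := fun w => expect_nonneg hm0 fun ω =>
    Finset.prod_nonneg fun f _ => by split_ifs <;> simp [hs0]
  refine (expect_mono hm0 fun ω => mul_le_mul_of_nonneg_left (h1 ω)
    (ind_nonneg _)).trans ?_
  rw [expect_star hm V₀ (fun ω => ind (∀ e ∈ H, ω e ∈ b)) g]
  · have h3 := prb_forall_mem hm H b
    rw [prb] at h3
    rw [h3, ← Finset.card_compl, ← Finset.prod_const (s := V₀ᶜ)]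
    refine mul_le_mul_of_nonneg_left ?_ (pow_nonneg (mass_nonneg hm0 b) _)
    exact Finset.prod_le_prod (fun w _ => h2 w) fun w _ =>
      expect_prod_star_le hm0 hm F (fun f hf => (hF f hf).1) w a hs0 hs1
  · intro x y hxy
    have : (∀ e ∈ H, x e ∈ b) ↔ ∀ e ∈ H, y e ∈ b :=
      forall₂_congr fun e he => by rw [hxy e (hH e he)]
    simp only [this]
  · intro w x y hxy
    refine Finset.prod_congr rfl fun f hf => ?_
    have : (∀ v ∈ f, x s(v, w) ∈ a) ↔ ∀ v ∈ f, y s(v, w) ∈ a :=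
      forall₂_congr fun v hv => by rw [hxy s(v, w) ⟨v, (hF f hf).2 hv, rfl⟩]
    simp only [this]

/-- The probability that two vertices are non-adjacent and have no common neighbour. -/
theorem prb_not_adj_and_codeg_eq_zero (hm : ∑ k, m k = 1) (a : Set κ) {u v : V} (huv : u ≠ v) :
    prb m (fun ω : Sym2 V → κ => ¬ (labelGraph a ω).Adj u v ∧ codeg (labelGraph a ω) {u, v} = 0)
      = (1 - mass m a) * (1 - mass m a ^ 2) ^ (Fintype.card V - 2) := by
  classical
  let g : V → (Sym2 V → κ) → ℝ := fun w ω =>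
    ind (¬ ∀ x ∈ ({u, v} : Finset V), ω s(x, w) ∈ a)
  have h1 : ∀ w, expect m (g w) = 1 - mass m a ^ 2 := fun w => by
    have h := prb_not hm (fun ω : Sym2 V → κ => ∀ x ∈ ({u, v} : Finset V), ω s(x, w) ∈ a)
    rw [prb_star_mem hm, Finset.card_pair huv] at h
    exact h
  have h2 : expect m (fun ω : Sym2 V → κ => ind (ω s(u, v) ∈ aᶜ)) = 1 - mass m a := by
    rw [← mass_compl hm]; exact prb_mem hm _ _
  have h3 := expect_star hm {u, v} (fun ω : Sym2 V → κ => ind (ω s(u, v) ∈ aᶜ)) g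
    (fun x y h => by
      have := h s(u, v) (by simp)
      simp only [this])
    (fun w x y h => by
      have : (∀ z ∈ ({u, v} : Finset V), x s(z, w) ∈ a) ↔
          ∀ z ∈ ({u, v} : Finset V), y s(z, w) ∈ a :=
        forall₂_congr fun z hz => by rw [h s(z, w) ⟨z, hz, rfl⟩]
      simp only [g, this])
  simp only [h1, h2, Finset.prod_const, Finset.card_compl, Finset.card_pair huv] at h3
  rw [← h3, prb]
  congr 1; ext ω
  simp only [g]
  rw [← ind_forall, ← ind_and]
  congr 1
  simp only [labelGraph_adj, codeg, Finset.card_eq_zero, Finset.eq_empty_iff_forall_notMem,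
    mem_commonNbrs, Finset.mem_compl, Finset.mem_insert, Finset.mem_singleton, not_or, not_and_or,
    forall_eq_or_imp, forall_eq, Set.mem_compl_iff]
  refine propext (and_congr (by simp [huv]) (forall_congr' fun w => ?_))
  by_cases hu : w = u
  · simp [hu]
  by_cases hv : w = v
  · simp [hv]
  simp [hu, hv, Ne.symm hu, Ne.symm hv]

end LabelledGraph

/-! ### Comparison of the random graph process with binomial random graphs -/

section Relabel

variable {V : Type*}

theorem mem_edgeSet_compl {G : SimpleGraph V} {e : Sym2 V} :
    e ∈ Gᶜ.edgeSet ↔ ¬ e.IsDiag ∧ e ∉ G.edgeSet := by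
  induction e with
  | h u v => simp [SimpleGraph.compl_adj]

theorem edgeSet_sup_edge {G : SimpleGraph V} {e : Sym2 V} (he : ¬ e.IsDiag) :
    (G ⊔ SimpleGraph.fromEdgeSet {e}).edgeSet = insert e G.edgeSet := by
  rw [SimpleGraph.edgeSet_sup, SimpleGraph.edgeSet_fromEdgeSet, Set.union_comm, Set.insert_eq]
  congr 1
  rw [sdiff_eq_left, Set.disjoint_left]
  rintro _ rfl; exact he

theorem mem_absentEdges [Fintype V] {G : SimpleGraph V} {e : Sym2 V} :
    e ∈ absentEdges G ↔ ¬ e.IsDiag ∧ e ∉ G.edgeSet := by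
  rw [absentEdges, Set.Finite.mem_toFinset, mem_edgeSet_compl]

variable [DecidableEq V]

/-- The pairs of distinct vertices. -/
abbrev Edge (V : Type*) : Type _ := {e : Sym2 V // ¬ e.IsDiag}

/-- The image of a graph under a permutation of the pairs of distinct vertices. -/
def relabel (π : Equiv.Perm (Edge V)) (G : SimpleGraph V) : SimpleGraph V :=
  SimpleGraph.fromEdgeSet (Equiv.Perm.ofSubtype π '' G.edgeSet)

theorem isDiag_ofSubtype_iff (π : Equiv.Perm (Edge V)) (e : Sym2 V) :
    (Equiv.Perm.ofSubtype π e).IsDiag ↔ e.IsDiag := by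
  exact not_iff_not.1 (Equiv.Perm.ofSubtype_apply_mem_iff_mem π e)

theorem edgeSet_relabel (π : Equiv.Perm (Edge V)) (G : SimpleGraph V) :
    (relabel π G).edgeSet = Equiv.Perm.ofSubtype π '' G.edgeSet := by
  rw [relabel, SimpleGraph.edgeSet_fromEdgeSet, sdiff_eq_left, Set.disjoint_left]
  rintro _ ⟨e, he, rfl⟩ h
  exact G.not_isDiag_of_mem_edgeSet he ((isDiag_ofSubtype_iff π e).1 h)

theorem relabel_mul (π ρ : Equiv.Perm (Edge V)) (G : SimpleGraph V) :
    relabel (π * ρ) G = relabel π (relabel ρ G) := by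
  rw [← SimpleGraph.edgeSet_inj]
  simp only [edgeSet_relabel, map_mul, Equiv.Perm.coe_mul, Set.image_comp]

theorem relabel_mono (π : Equiv.Perm (Edge V)) {G H : SimpleGraph V} (h : G ≤ H) :
    relabel π G ≤ relabel π H := by
  rw [← SimpleGraph.edgeSet_subset_edgeSet] at *
  rw [edgeSet_relabel, edgeSet_relabel]
  exact Set.image_mono h

variable [Fintype V]

theorem absentEdges_relabel (π : Equiv.Perm (Edge V)) (G : SimpleGraph V) :
    absentEdges (relabel π G) = (absentEdges G).map (Equiv.Perm.ofSubtype π).toEmbedding := by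
  ext e
  rw [Finset.mem_map_equiv, mem_absentEdges, mem_absentEdges, edgeSet_relabel,
    Set.mem_image_equiv, ← isDiag_ofSubtype_iff π (Equiv.symm _ e), Equiv.apply_symm_apply]

theorem uniformOfFinset_map_equiv {α : Type*} (σ : Equiv.Perm α) (s : Finset α)
    (hs : s.Nonempty) (hs' : (s.map σ.toEmbedding).Nonempty) :
    (PMF.uniformOfFinset s hs).map σ = PMF.uniformOfFinset (s.map σ.toEmbedding) hs' := by
  classical
  ext b
  rw [PMF.map_apply, tsum_eq_single (σ.symm b)]
  · rw [PMF.uniformOfFinset_apply, PMF.uniformOfFinset_apply]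
    simp [Finset.mem_map_equiv]
  · intro a ha
    rw [if_neg]
    rintro rfl; simp at ha

theorem step_map_relabel (π : Equiv.Perm (Edge V)) (G : SimpleGraph V) :
    (step G).map (relabel π) = step (relabel π G) := by
  by_cases h : (absentEdges G).Nonempty
  · have h' : (absentEdges (relabel π G)).Nonempty := by
      rw [absentEdges_relabel]; exact h.map
    rw [step, step, dif_pos h, dif_pos h', PMF.map_comp]
    have h1 : PMF.uniformOfFinset (absentEdges (relabel π G)) h'
        = (PMF.uniformOfFinset (absentEdges G) h).map (Equiv.Perm.ofSubtype π) := by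
      rw [uniformOfFinset_map_equiv _ _ _ h.map]
      congr 1; exact absentEdges_relabel π G
    rw [h1, PMF.map_comp]
    ext H
    rw [PMF.map_apply, PMF.map_apply]
    refine tsum_congr fun e => ?_
    by_cases he : e ∈ absentEdges G
    · have h2 : (relabel π ∘ fun e => G ⊔ SimpleGraph.fromEdgeSet {e}) e
          = ((fun e => relabel π G ⊔ SimpleGraph.fromEdgeSet {e}) ∘ Equiv.Perm.ofSubtype π) e := by
        rw [mem_absentEdges] at he
        rw [← SimpleGraph.edgeSet_inj, Function.comp_apply, Function.comp_apply, edgeSet_relabel,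
          edgeSet_sup_edge he.1, edgeSet_sup_edge (mt (isDiag_ofSubtype_iff π e).1 he.1),
          edgeSet_relabel, Set.image_insert_eq]
      rw [h2]
    · rw [PMF.uniformOfFinset_apply_of_notMem h he]; simp
  · have h' : ¬ (absentEdges (relabel π G)).Nonempty := by
      rw [absentEdges_relabel, Finset.map_nonempty]; exact h
    rw [step, step, dif_neg h, dif_neg h', PMF.pure_map]

/-- The law of the random graph process is invariant under permutations of the edges. -/
theorem processLaw_map_relabel (π : Equiv.Perm (Edge V)) (t : ℕ) :
    (processLaw V t).map (fun g i => relabel π (g i)) = processLaw V t := by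
  induction t with
  | zero =>
    rw [processLaw, PMF.pure_map]
    congr 1; ext1 i
    rw [← SimpleGraph.edgeSet_inj, edgeSet_relabel]; simp
  | succ t ih =>
    have h1 : ∀ g : Fin (t + 1) → SimpleGraph V,
        ((step (g (Fin.last t))).map fun H =>
          (Fin.snoc (α := fun _ => SimpleGraph V) g H : Fin (t + 2) → SimpleGraph V)).map
            (fun g i => relabel π (g i))
        = (step (relabel π (g (Fin.last t)))).map fun H =>
            Fin.snoc (α := fun _ => SimpleGraph V) (fun i => relabel π (g i)) H := by
      intro g
      rw [← step_map_relabel, PMF.map_comp, PMF.map_comp]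
      congr 1; ext1 H; ext1 i
      refine Fin.lastCases ?_ (fun j => ?_) i
      · simp
      · simp
    conv_rhs => rw [processLaw, ← ih]
    rw [processLaw, PMF.map_bind, PMF.bind_map]
    congr 1; ext1 g
    exact h1 g

end Relabel

section Trajectories

variable {V : Type*} [DecidableEq V] [Fintype V]

theorem ncard_edgeSet_top : (⊤ : SimpleGraph V).edgeSet.ncard = (Fintype.card V).choose 2 := by
  rw [← SimpleGraph.card_edgeFinset_top_eq_card_choose_two, ← SimpleGraph.coe_edgeFinset,
    Set.ncard_coe_finset]

theorem absentEdges_nonempty {G : SimpleGraph V}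
    (h : G.edgeSet.ncard < (Fintype.card V).choose 2) : (absentEdges G).Nonempty := by
  by_contra hne
  rw [Finset.not_nonempty_iff_eq_empty] at hne
  have : G = ⊤ := by
    rw [← SimpleGraph.edgeSet_inj]
    ext e
    have h1 := mem_absentEdges (G := G) (e := e)
    rw [hne] at h1
    simp only [Finset.notMem_empty, false_iff, not_and, not_not] at h1
    simp only [SimpleGraph.edgeSet_top, Set.mem_compl_iff]
    exact ⟨G.not_isDiag_of_mem_edgeSet, h1⟩
  rw [this, ncard_edgeSet_top] at h
  exact lt_irrefl _ h

/-- Along the process the graphs increase and `G_i` has `i` edges. -/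
theorem of_mem_support_processLaw {t : ℕ} (ht : t ≤ (Fintype.card V).choose 2)
    {g : Fin (t + 1) → SimpleGraph V} (hg : g ∈ (processLaw V t).support) :
    Monotone g ∧ ∀ i, (g i).edgeSet.ncard = i := by
  induction t with
  | zero =>
    rw [processLaw, PMF.support_pure, Set.mem_singleton_iff] at hg
    subst hg
    exact ⟨fun _ _ _ => le_rfl, fun i => by simp⟩
  | succ t ih =>
    rw [processLaw, PMF.mem_support_bind_iff] at hg
    obtain ⟨g', hg', hg⟩ := hg
    rw [PMF.support_map] at hg
    obtain ⟨H, hH, rfl⟩ := hg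
    obtain ⟨hmono, hcard⟩ := ih (by omega) hg'
    have hlast : (g' (Fin.last t)).edgeSet.ncard < (Fintype.card V).choose 2 := by
      rw [hcard]; simpa using ht
    rw [step, dif_pos (absentEdges_nonempty hlast), PMF.support_map] at hH
    obtain ⟨e, he, rfl⟩ := hH
    rw [PMF.support_uniformOfFinset, Finset.mem_coe, mem_absentEdges] at he
    constructor
    · intro i j
      refine Fin.lastCases ?_ (fun i => ?_) i <;> refine Fin.lastCases ?_ (fun j => ?_) j
      · intro _; exact le_rfl
      · intro h; exact absurd h (not_le.2 (Fin.castSucc_lt_last j))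
      · intro _
        simp only [Fin.snoc_castSucc, Fin.snoc_last]
        exact (hmono (Fin.le_last i)).trans le_sup_left
      · intro h
        simp only [Fin.snoc_castSucc]
        exact hmono (Fin.castSucc_le_castSucc_iff.1 h)
    · intro i
      refine Fin.lastCases ?_ (fun i => ?_) i
      · simp only [Fin.snoc_last, Fin.val_last]
        rw [edgeSet_sup_edge he.1, Set.ncard_insert_of_notMem he.2 (Set.toFinite _), hcard]
        simp
      · simp only [Fin.snoc_castSucc, Fin.val_castSucc]
        exact hcard i

end Trajectories

section Transfer

theorem relabel_labelGraph {V κ : Type*} [DecidableEq V] (π : Equiv.Perm (Edge V))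
    (a : Set κ) (ω : Sym2 V → κ) :
    relabel π (labelGraph a (fun e => ω (Equiv.Perm.ofSubtype π e))) = labelGraph a ω := by
  rw [← SimpleGraph.edgeSet_inj, edgeSet_relabel]
  ext e
  rw [Set.mem_image_equiv]
  simp only [labelGraph, SimpleGraph.edgeSet_fromEdgeSet, Set.mem_sdiff, Set.mem_ofPred_eq,
    Equiv.apply_symm_apply]
  rw [Sym2.mem_diagSet, Sym2.mem_diagSet, ← isDiag_ofSubtype_iff π (Equiv.symm _ e),
    Equiv.apply_symm_apply]

/-- Nested pairs of sets with comparable sizes can be nested into each other by a permutation. -/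
theorem exists_perm_nested {ι : Type*} [Fintype ι] [DecidableEq ι] {S₁ S₂ T₁ T₂ : Finset ι}
    (hS : S₁ ⊆ S₂) (hT : T₁ ⊆ T₂) (h₁ : #T₁ ≤ #S₁) (h₂ : #S₂ ≤ #T₂) :
    ∃ π : Equiv.Perm ι, (∀ i ∈ T₁, π i ∈ S₁) ∧ ∀ i ∈ S₂, π.symm i ∈ T₂ := by
  obtain ⟨S, hS1, hSc⟩ := Finset.exists_subset_card_eq h₁
  obtain ⟨T, hT1, hT2, hTc⟩ := Finset.exists_subsuperset_card_eq hT
    (h₁.trans (Finset.card_le_card hS)) h₂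
  let c (A B : Finset ι) (i : ι) : Fin 3 := if i ∈ A then 0 else if i ∈ B then 1 else 2
  have c0 : ∀ A B i, c A B i = 0 ↔ i ∈ A := fun A B i => by
    simp only [c]; split_ifs <;> simp_all
  have c1 : ∀ A B i, c A B i = 1 ↔ i ∈ B \ A := fun A B i => by
    simp only [c, Finset.mem_sdiff]; split_ifs <;> simp_all
  have c2 : ∀ A B, A ⊆ B → ∀ i, c A B i = 2 ↔ i ∈ Bᶜ := fun A B h i => by
    simp only [c, Finset.mem_compl]
    by_cases hA : i ∈ A
    · simp [hA, h hA]
    · by_cases hB : i ∈ B <;> simp [hA, hB]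
  have hcard : ∀ k, Nonempty ({i // c T₁ T i = k} ≃ {i // c S S₂ i = k}) := by
    intro k
    rw [← Fintype.card_eq]
    have hSS := hS1.trans hS
    fin_cases k
    · simp only [Fin.zero_eta, c0, Fintype.card_coe]; exact hSc.symm
    · simp only [Fin.mk_one, c1, Fintype.card_coe]
      rw [Finset.card_sdiff_of_subset hT1, Finset.card_sdiff_of_subset hSS]; omega
    · simp only [Fin.reduceFinMk, c2 _ _ hT1, c2 _ _ hSS, Fintype.card_coe, Finset.card_compl]
      omega
  let π : Equiv.Perm ι := (Equiv.sigmaFiberEquiv (c T₁ T)).symm.trans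
    ((Equiv.sigmaCongrRight fun k => (hcard k).some).trans (Equiv.sigmaFiberEquiv (c S S₂)))
  have hπ : ∀ i, c S S₂ (π i) = c T₁ T i := fun i =>
    ((hcard (c T₁ T i)).some ⟨i, rfl⟩).2
  refine ⟨π, fun i hi => hS1 ((c0 S S₂ _).1 ?_), fun i hi => hT2 ?_⟩
  · rw [hπ, c0]; exact hi
  · by_contra hn
    have h := hπ (π.symm i)
    rw [Equiv.apply_symm_apply, (c2 T₁ T hT1 _).2 (Finset.mem_compl.2 hn),
      c2 S S₂ (hS1.trans hS)] at h
    exact Finset.mem_compl.1 h hi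

variable {V : Type*} [DecidableEq V] [Fintype V]

theorem exists_relabel_le {G₁ G₂ H₁ H₂ : SimpleGraph V} (hG : G₁ ≤ G₂) (hH : H₁ ≤ H₂)
    (h₁ : H₁.edgeSet.ncard ≤ G₁.edgeSet.ncard) (h₂ : G₂.edgeSet.ncard ≤ H₂.edgeSet.ncard) :
    ∃ π : Equiv.Perm (Edge V), relabel π H₁ ≤ G₁ ∧ G₂ ≤ relabel π H₂ := by
  classical
  let E : SimpleGraph V → Finset (Edge V) := fun G => Finset.univ.filter fun e => e.1 ∈ G.edgeSet
  have hE : ∀ G, #(E G) = G.edgeSet.ncard := fun G => by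
    rw [← Set.ncard_coe_finset, ← Set.ncard_image_of_injective _ Subtype.val_injective]
    congr 1; ext e
    simp only [E, Finset.coe_filter, Finset.mem_univ, true_and, Set.mem_image, Set.mem_ofPred_eq]
    exact ⟨fun ⟨x, hx, h⟩ => h ▸ hx, fun h => ⟨⟨e, G.not_isDiag_of_mem_edgeSet h⟩, h, rfl⟩⟩
  have hmono : ∀ {G H : SimpleGraph V}, G ≤ H → E G ⊆ E H := fun h e he => by
    simp only [E, Finset.mem_filter, Finset.mem_univ, true_and] at *
    exact SimpleGraph.edgeSet_subset_edgeSet.2 h he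
  obtain ⟨π, hπ1, hπ2⟩ := exists_perm_nested (hmono hG) (hmono hH)
    (by rw [hE, hE]; exact h₁) (by rw [hE, hE]; exact h₂)
  refine ⟨π, ?_, ?_⟩
  · rw [← SimpleGraph.edgeSet_subset_edgeSet, edgeSet_relabel]
    rintro _ ⟨e, he, rfl⟩
    have hd := H₁.not_isDiag_of_mem_edgeSet he
    have := hπ1 ⟨e, hd⟩ (by simpa [E] using he)
    rw [Equiv.Perm.ofSubtype_apply_of_mem π hd]
    simpa [E] using this
  · rw [← SimpleGraph.edgeSet_subset_edgeSet, edgeSet_relabel]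
    intro e he
    have hd := G₂.not_isDiag_of_mem_edgeSet he
    have := hπ2 ⟨e, hd⟩ (by simpa [E] using he)
    refine ⟨(π.symm ⟨e, hd⟩).1, by simpa [E] using this, ?_⟩
    rw [Equiv.Perm.ofSubtype_apply_coe]; simp

/-- The number of permutations of the edges which take the pair `(G₁, G₂)` into `E`. -/
def permCount (E : SimpleGraph V → SimpleGraph V → Prop) (G₁ G₂ : SimpleGraph V) : ℝ :=
  ∑ π : Equiv.Perm (Edge V), ind (E (relabel π G₁) (relabel π G₂))

theorem permCount_le {E : SimpleGraph V → SimpleGraph V → Prop}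
    (hE : ∀ G₁ G₂ H₁ H₂, H₁ ≤ G₁ → G₂ ≤ H₂ → E G₁ G₂ → E H₁ H₂) {G₁ G₂ H₁ H₂ : SimpleGraph V}
    (hG : G₁ ≤ G₂) (hH : H₁ ≤ H₂) (h₁ : H₁.edgeSet.ncard ≤ G₁.edgeSet.ncard)
    (h₂ : G₂.edgeSet.ncard ≤ H₂.edgeSet.ncard) : permCount E G₁ G₂ ≤ permCount E H₁ H₂ := by
  obtain ⟨ρ, hρ1, hρ2⟩ := exists_relabel_le hG hH h₁ h₂
  have h : permCount E H₁ H₂ = ∑ π : Equiv.Perm (Edge V),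
      ind (E (relabel π (relabel ρ H₁)) (relabel π (relabel ρ H₂))) := by
    rw [permCount, ← Equiv.sum_comp (Equiv.mulRight ρ)]
    simp [relabel_mul]
  rw [h]
  exact Finset.sum_le_sum fun π _ => ind_mono
    (hE _ _ _ _ (relabel_mono π hρ1) (relabel_mono π hρ2))

variable {κ : Type*} [Fintype κ] {m : κ → ℝ}

theorem expect_permCount (E : SimpleGraph V → SimpleGraph V → Prop) (a b : Set κ) :
    expect m (fun ω : Sym2 V → κ => permCount E (labelGraph a ω) (labelGraph b ω))
      = Fintype.card (Equiv.Perm (Edge V)) *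
        prb m (fun ω => E (labelGraph a ω) (labelGraph b ω)) := by
  simp only [permCount]
  rw [expect_sum, Finset.sum_congr rfl, Finset.sum_const, nsmul_eq_mul, Finset.card_univ]
  intro π _
  rw [prb, expect, expect]
  refine (Fintype.sum_equiv ((Equiv.Perm.ofSubtype π).arrowCongr (Equiv.refl κ)).symm _ _
    fun ω => ?_).symm
  congr 1
  · exact (Equiv.prod_comp (Equiv.Perm.ofSubtype π) fun e => m (ω e)).symm
  · change _ = ind (E (relabel π (labelGraph a (fun e => ω (Equiv.Perm.ofSubtype π e))))
      (relabel π (labelGraph b (fun e => ω (Equiv.Perm.ofSubtype π e)))))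
    rw [relabel_labelGraph, relabel_labelGraph]

/-- Comparison of the process with the labelled binomial random graph. If an event `E` becomes
more likely when the first graph shrinks and the second one grows, then its probability for
`(G_{t₁}, G_{t₂})` is bounded by its probability for two nested binomial random graphs, up to the
probability that these have at most `t₁`, respectively at least `t₂` edges. -/
theorem prob_process_le (hm0 : ∀ k, 0 ≤ m k) {E : SimpleGraph V → SimpleGraph V → Prop}
    (hE : ∀ G₁ G₂ H₁ H₂, H₁ ≤ G₁ → G₂ ≤ H₂ → E G₁ G₂ → E H₁ H₂) {a b : Set κ} (hab : a ⊆ b)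
    {t : ℕ} (ht : t ≤ (Fintype.card V).choose 2) {t₁ t₂ : Fin (t + 1)} (h12 : t₁ ≤ t₂) {c : ℝ}
    (hc : 0 < c) (hgood : c ≤ prb m (fun ω : Sym2 V → κ =>
      (labelGraph a ω).edgeSet.ncard ≤ t₁ ∧ t₂ ≤ (labelGraph b ω).edgeSet.ncard)) :
    prob (processLaw V t) {g | E (g t₁) (g t₂)}
      ≤ ENNReal.ofReal (prb m (fun ω : Sym2 V → κ => E (labelGraph a ω) (labelGraph b ω)) / c) := by
  obtain ⟨M, hM⟩ : ∃ M : ℝ, M = Fintype.card (Equiv.Perm (Edge V)) := ⟨_, rfl⟩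
  have hMpos : 0 < M := by rw [hM]; exact_mod_cast Fintype.card_pos
  set q := prb m (fun ω : Sym2 V → κ => E (labelGraph a ω) (labelGraph b ω)) with hq
  have hab' : ∀ ω : Sym2 V → κ, labelGraph a ω ≤ labelGraph b ω := fun ω u v h => by
    rw [labelGraph_adj] at *; exact ⟨hab h.1, h.2⟩
  have key : ∀ g ∈ (processLaw V t).support, permCount E (g t₁) (g t₂) ≤ M * (q / c) := by
    intro g hg
    obtain ⟨hmono, hcard⟩ := of_mem_support_processLaw ht hg
    have h0 : 0 ≤ permCount E (g t₁) (g t₂) := Finset.sum_nonneg fun _ _ => ind_nonneg _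
    have h1 : permCount E (g t₁) (g t₂) * prb m (fun ω : Sym2 V → κ =>
        (labelGraph a ω).edgeSet.ncard ≤ t₁ ∧ t₂ ≤ (labelGraph b ω).edgeSet.ncard) ≤ M * q := by
      rw [hM, hq, ← expect_permCount, prb, ← expect_const_mul]
      refine expect_mono hm0 fun ω => ?_
      by_cases hω : (labelGraph a ω).edgeSet.ncard ≤ t₁ ∧ t₂ ≤ (labelGraph b ω).edgeSet.ncard
      · rw [ind_true hω, mul_one]
        exact permCount_le hE (hmono h12) (hab' ω) (by rw [hcard]; exact hω.1)
          (by rw [hcard]; exact hω.2)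
      · rw [ind_false hω, mul_zero]
        exact Finset.sum_nonneg fun _ _ => ind_nonneg _
    rw [← mul_div_assoc, le_div_iff₀ hc]
    exact (mul_le_mul_of_nonneg_left hgood h0).trans h1
  set P := prob (processLaw V t) {g | E (g t₁) (g t₂)} with hP
  have hπ : ∀ π : Equiv.Perm (Edge V),
      P = ∑' g, processLaw V t g *
        ENNReal.ofReal (ind (E (relabel π (g t₁)) (relabel π (g t₂)))) := by
    intro π
    rw [hP, prob, ← processLaw_map_relabel π t, PMF.toOuterMeasure_map_apply,
      PMF.toOuterMeasure_apply, processLaw_map_relabel π t]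
    refine tsum_congr fun g => ?_
    by_cases h : E (relabel π (g t₁)) (relabel π (g t₂))
    · rw [ind_true h, Set.indicator_of_mem (by exact h)]; simp
    · rw [ind_false h, Set.indicator_of_notMem (by exact h)]; simp
  have hsum : ENNReal.ofReal M * P ≤ ENNReal.ofReal (M * (q / c)) := by
    calc ENNReal.ofReal M * P = ∑ π : Equiv.Perm (Edge V), P := by
          rw [Finset.sum_const, nsmul_eq_mul, Finset.card_univ, hM, ENNReal.ofReal_natCast]
      _ = ∑' g, processLaw V t g * ENNReal.ofReal (permCount E (g t₁) (g t₂)) := by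
          rw [Finset.sum_congr rfl fun π _ => hπ π,
            ← Summable.tsum_finsetSum fun _ _ => ENNReal.summable]
          refine tsum_congr fun g => ?_
          rw [← Finset.mul_sum, permCount, ENNReal.ofReal_sum_of_nonneg fun _ _ => ind_nonneg _]
      _ ≤ ∑' g, processLaw V t g * ENNReal.ofReal (M * (q / c)) := by
          refine ENNReal.tsum_le_tsum fun g => ?_
          by_cases hg : g ∈ (processLaw V t).support
          · gcongr; exact key g hg
          · rw [PMF.mem_support_iff, not_not] at hg; simp [hg]
      _ = ENNReal.ofReal (M * (q / c)) := by
          rw [ENNReal.tsum_mul_right, PMF.tsum_coe, one_mul]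
  rw [ENNReal.ofReal_mul hMpos.le] at hsum
  exact (ENNReal.mul_le_mul_iff_right (by simpa using hMpos) ENNReal.ofReal_ne_top).1 hsum

end Transfer

/-! ### Moment estimates for the diameter -/

section ElementarySymmetric

variable {α : Type*} [DecidableEq α]

theorem succ_mul_sum_powersetCard (X : Finset α) (a : α → ℝ) (k : ℕ) :
    (k + 1) * ∑ T ∈ X.powersetCard (k + 1), ∏ x ∈ T, a x
      = ∑ S ∈ X.powersetCard k, (∏ x ∈ S, a x) * ∑ x ∈ X \ S, a x := by
  have h1 : (k + 1) * ∑ T ∈ X.powersetCard (k + 1), ∏ x ∈ T, a x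
      = ∑ T ∈ X.powersetCard (k + 1), ∑ _x ∈ T, ∏ x ∈ T, a x := by
    rw [Finset.mul_sum]
    refine Finset.sum_congr rfl fun T hT => ?_
    rw [Finset.sum_const, (Finset.mem_powersetCard.1 hT).2, nsmul_eq_mul]; push_cast; ring
  rw [h1]
  simp only [Finset.mul_sum]
  rw [Finset.sum_sigma', Finset.sum_sigma']
  refine Finset.sum_bij' (fun q _ => ⟨q.1.erase q.2, q.2⟩) (fun q _ => ⟨insert q.2 q.1, q.2⟩)
    ?_ ?_ ?_ ?_ ?_
  · rintro ⟨T, x⟩ h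
    simp only [Finset.mem_sigma, Finset.mem_powersetCard, Finset.mem_sdiff] at h ⊢
    refine ⟨⟨(Finset.erase_subset _ _).trans h.1.1, ?_⟩, h.1.1 h.2, by simp⟩
    rw [Finset.card_erase_of_mem h.2, h.1.2]; rfl
  · rintro ⟨S, x⟩ h
    simp only [Finset.mem_sigma, Finset.mem_powersetCard, Finset.mem_sdiff] at h ⊢
    refine ⟨⟨Finset.insert_subset h.2.1 h.1.1, ?_⟩, by simp⟩
    rw [Finset.card_insert_of_notMem h.2.2, h.1.2]
  · rintro ⟨T, x⟩ h
    simp only [Finset.mem_sigma] at h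
    simp [Finset.insert_erase h.2]
  · rintro ⟨S, x⟩ h
    simp only [Finset.mem_sigma, Finset.mem_sdiff] at h
    simp [Finset.erase_insert h.2.2]
  · rintro ⟨T, x⟩ h
    simp only [Finset.mem_sigma] at h
    exact (Finset.prod_erase_mul _ _ h.2).symm

/-- If a sum is large although its terms are small, then its elementary symmetric functions are
large. -/
theorem pow_le_factorial_mul_sum_powersetCard (X : Finset α) (a : α → ℝ) {θ η : ℝ} {K : ℕ}
    (h0 : ∀ x, 0 ≤ a x) (hη : ∀ x, a x ≤ η) (hη0 : 0 ≤ η) (hθ : K * η ≤ θ)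
    (hX : θ ≤ ∑ x ∈ X, a x) (k : ℕ) (hk : k ≤ K) :
    (θ - K * η) ^ k ≤ k.factorial * ∑ S ∈ X.powersetCard k, ∏ x ∈ S, a x := by
  induction k with
  | zero => simp
  | succ k ih =>
    have h1 : ∀ S ∈ X.powersetCard k, θ - K * η ≤ ∑ x ∈ X \ S, a x := fun S hS => by
      rw [Finset.mem_powersetCard] at hS
      have h2 := Finset.sum_sdiff (f := a) hS.1
      have h3 : ∑ x ∈ S, a x ≤ k * η := by
        refine (Finset.sum_le_sum fun x _ => hη x).trans ?_
        rw [Finset.sum_const, hS.2, nsmul_eq_mul]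
      have h4 : (k : ℝ) * η ≤ K * η := by
        have : (k : ℝ) ≤ K := by exact_mod_cast (by omega : k ≤ K)
        gcongr
      linarith
    rw [Nat.factorial_succ, mul_comm (k + 1), Nat.cast_mul, mul_assoc, Nat.cast_succ,
      succ_mul_sum_powersetCard, pow_succ]
    calc (θ - K * η) ^ k * (θ - K * η)
        ≤ (k.factorial * ∑ S ∈ X.powersetCard k, ∏ x ∈ S, a x) * (θ - K * η) :=
          mul_le_mul_of_nonneg_right (ih (by omega)) (by linarith)
      _ = k.factorial * ∑ S ∈ X.powersetCard k, (∏ x ∈ S, a x) * (θ - K * η) := by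
          rw [mul_assoc, Finset.sum_mul]
      _ ≤ _ := by
          refine mul_le_mul_of_nonneg_left (Finset.sum_le_sum fun S hS => ?_) (by positivity)
          exact mul_le_mul_of_nonneg_left (h1 S hS) (Finset.prod_nonneg fun x _ => h0 x)

end ElementarySymmetric

section Probability

variable {ι κ : Type*} [Fintype ι] [DecidableEq ι] [Fintype κ] {m : κ → ℝ}

theorem prb_exists_le (hm0 : ∀ k, 0 ≤ m k) {α : Type*} (s : Finset α)
    (E : α → (ι → κ) → Prop) {B : ℝ} (h : ∀ i ∈ s, prb m (E i) ≤ B) :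
    prb m (fun ω => ∃ i ∈ s, E i ω) ≤ #s * B := by
  have h1 : prb m (fun ω => ∃ i ∈ s, E i ω) ≤ expect m (fun ω => ∑ i ∈ s, ind (E i ω)) :=
    prb_le_expect hm0 (fun ω => Finset.sum_nonneg fun _ _ => ind_nonneg _) fun ω ⟨i, hi, hE⟩ => by
      rw [← ind_true hE]
      exact Finset.single_le_sum (f := fun i => ind (E i ω)) (fun _ _ => ind_nonneg _) hi
  refine h1.trans ?_
  rw [expect_sum]
  exact (Finset.sum_le_sum h).trans (by rw [Finset.sum_const, nsmul_eq_mul])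

theorem prb_false {E : (ι → κ) → Prop} (h : ∀ ω, ¬ E ω) : prb m E = 0 := by
  simp [prb, expect, ind_false (h _)]

/-- Existence of an `α`-quantile. -/
theorem exists_quantile (hm : ∑ k, m k = 1) (X : (ι → κ) → ℕ) {N : ℕ}
    (hX : ∀ ω, X ω ≤ N) {α : ℝ} (hα0 : 0 ≤ α) (hα : α ≤ 1) :
    ∃ t ≤ N, α ≤ prb m (fun ω => X ω ≤ t) ∧ 1 - α ≤ prb m (fun ω => t ≤ X ω) := by
  classical
  have hone : ∀ E : (ι → κ) → Prop, (∀ ω, E ω) → prb m E = 1 := fun E hE => by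
    have h := prb_not hm (fun ω => ¬ E ω)
    rw [prb_false (E := fun ω => ¬ E ω) fun ω h => h (hE ω)] at h
    simpa using h
  have hN : α ≤ prb m (fun ω => X ω ≤ N) := by rw [hone _ hX]; exact hα
  have hex : ∃ t, α ≤ prb m (fun ω => X ω ≤ t) := ⟨N, hN⟩
  refine ⟨Nat.find hex, Nat.find_min' hex hN, Nat.find_spec hex, ?_⟩
  cases ht : Nat.find hex with
  | zero => rw [hone _ fun ω => Nat.zero_le _]; linarith
  | succ k =>
    have h1 := Nat.find_min hex (m := k) (by omega)
    have h2 := prb_not hm (fun ω => X ω ≤ k)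
    simp only [not_le] at h1 h2
    simp only [Nat.succ_le_iff]
    linarith

end Probability

section SingleGraph

variable {V κ : Type*} [Fintype V] [DecidableEq V] [Fintype κ] {m : κ → ℝ}

theorem exists_pair_of_not_propD {G : SimpleGraph V} (h : ¬ PropD G) :
    ∃ u v, u ≠ v ∧ ¬ G.Adj u v ∧ codeg G {u, v} = 0 := by
  rw [propD_iff] at h
  push Not at h
  obtain ⟨u, v, huv, hadj, h⟩ := h
  refine ⟨u, v, huv, hadj, ?_⟩
  rw [codeg, Finset.card_eq_zero, Finset.eq_empty_iff_forall_notMem]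
  intro w hw
  rw [mem_commonNbrs] at hw
  exact h w (hw u (by simp)) (hw v (by simp))

theorem prb_codeg_eq_zero_le (hm0 : ∀ k, 0 ≤ m k) (hm : ∑ k, m k = 1) (a : Set κ)
    (F : Finset (Finset V)) (hF : ∀ f ∈ F, #f = 2) :
    prb m (fun ω : Sym2 V → κ => ∀ f ∈ F, codeg (labelGraph a ω) f = 0)
      ≤ (1 - (#F * mass m a ^ 2 - #F ^ 2 * mass m a ^ 3)) ^ (Fintype.card V - #(F.biUnion id)) := by
  have h := expect_edges_mul_codeg_le hm0 hm (F.biUnion id) F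
    (fun f hf => ⟨hF f hf, Finset.subset_biUnion_of_mem id hf⟩) ∅ (by simp) a a
    (s := 0) le_rfl zero_le_one
  simp only [Finset.card_empty, pow_zero, one_mul, sub_zero] at h
  refine le_trans (expect_mono hm0 fun ω => le_of_eq ?_) h
  rw [ind_forall, ind_true (P := ∀ e ∈ (∅ : Finset (Sym2 V)), ω e ∈ a) (by simp), one_mul]
  refine Finset.prod_congr rfl fun f _ => ?_
  by_cases h0 : codeg (labelGraph a ω) f = 0
  · rw [ind_true h0, h0, pow_zero]
  · rw [ind_false h0, zero_pow h0]

/-- First moment bound for the probability that the diameter exceeds two. -/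
theorem prb_not_propD_le (hm0 : ∀ k, 0 ≤ m k) (hm : ∑ k, m k = 1) (a : Set κ) :
    prb m (fun ω : Sym2 V → κ => ¬ PropD (labelGraph a ω))
      ≤ (Fintype.card V).choose 2 *
        (1 - (mass m a ^ 2 - mass m a ^ 3)) ^ (Fintype.card V - 2) := by
  have h1 := prb_exists_le (m := m) hm0 ((Finset.univ : Finset V).powersetCard 2)
    (fun f (ω : Sym2 V → κ) => codeg (labelGraph a ω) f = 0)
    (B := (1 - (mass m a ^ 2 - mass m a ^ 3)) ^ (Fintype.card V - 2)) (fun f hf => by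
      rw [Finset.mem_powersetCard] at hf
      have := prb_codeg_eq_zero_le hm0 hm a {f} (by simp [hf.2])
      simpa [hf.2] using this)
  rw [Finset.card_powersetCard, Finset.card_univ] at h1
  refine (prb_mono hm0 fun ω hω => ?_).trans h1
  obtain ⟨u, v, huv, -, h⟩ := exists_pair_of_not_propD hω
  exact ⟨{u, v}, by simp [Finset.mem_powersetCard, huv], h⟩

/-- Second moment bound for the probability that the diameter is at most two. -/
theorem prb_propD_le (hm0 : ∀ k, 0 ≤ m k) (hm : ∑ k, m k = 1) (a : Set κ) {p q Q K : ℝ}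
    (hp : mass m a = p) (hp2 : p ≤ 1 / 2)
    (hq : (1 - p) * (1 - p ^ 2) ^ (Fintype.card V - 2) = q) (hq0 : 0 < q)
    (hQ : (1 - (2 * p ^ 2 - 4 * p ^ 3)) ^ (Fintype.card V - 4) = Q)
    (hK : ((Fintype.card V).choose 2 : ℝ) = K) (hK0 : 0 < K) :
    prb m (fun ω : Sym2 V → κ => PropD (labelGraph a ω)) ≤ 1 / (K * q) + (Q / q ^ 2 - 1) := by
  have hp0 : 0 ≤ p := hp ▸ mass_nonneg hm0 a
  let I : Finset V → (Sym2 V → κ) → Prop := fun f ω =>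
    (∀ u ∈ f, ∀ v ∈ f, ¬ (labelGraph a ω).Adj u v) ∧ codeg (labelGraph a ω) f = 0
  let P := (Finset.univ : Finset V).powersetCard 2
  have hP : ∀ f ∈ P, #f = 2 := fun f hf => (Finset.mem_powersetCard.1 hf).2
  have hPc : (#P : ℝ) = K := by rw [← hK, Finset.card_powersetCard, Finset.card_univ]
  have h1 : ∀ f ∈ P, prb m (I f) = q := by
    intro f hf
    obtain ⟨u, v, huv, rfl⟩ := Finset.card_eq_two.1 (hP f hf)
    rw [← hq, ← hp, ← prb_not_adj_and_codeg_eq_zero hm a huv]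
    congr 1; ext ω
    simp [I, SimpleGraph.adj_comm]
  have hbase0 : 0 ≤ 1 - (2 * p ^ 2 - 4 * p ^ 3) := by nlinarith [pow_nonneg hp0 3]
  have hbase1 : 1 - (2 * p ^ 2 - 4 * p ^ 3) ≤ 1 := by nlinarith [pow_nonneg hp0 2]
  have hQ0 : 0 ≤ Q := by rw [← hQ]; exact pow_nonneg hbase0 _
  have h2 : ∀ f ∈ P, ∀ f' ∈ P, f ≠ f' → prb m (fun ω => I f ω ∧ I f' ω) ≤ Q := by
    intro f hf f' hf' hne
    have h := prb_codeg_eq_zero_le hm0 hm a {f, f'} (by simp [hP f hf, hP f' hf'])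
    rw [Finset.card_pair hne, hp] at h
    have hc : #(f ∪ f') ≤ 4 := by
      refine (Finset.card_union_le _ _).trans ?_
      simp [hP f hf, hP f' hf']
    refine (prb_mono hm0 fun ω hω => ?_).trans (h.trans ?_)
    · simp only [Finset.mem_insert, Finset.mem_singleton, forall_eq_or_imp, forall_eq]
      exact ⟨hω.1.2, hω.2.2⟩
    · rw [← hQ]
      norm_num
      exact pow_le_pow_of_le_one hbase0 hbase1 (by omega)
  let Z : (Sym2 V → κ) → ℝ := fun ω => ∑ f ∈ P, ind (I f ω)
  have hZ : expect m Z = K * q := by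
    simp only [Z]
    rw [expect_sum]
    refine (Finset.sum_congr rfl h1).trans ?_
    rw [Finset.sum_const, nsmul_eq_mul, hPc]
  have hZ2 : expect m (fun ω => Z ω * Z ω) ≤ K * q + K * K * Q := by
    have h3 : (fun ω => Z ω * Z ω)
        = fun ω => ∑ f ∈ P, ∑ f' ∈ P, ind (I f ω ∧ I f' ω) := by
      ext ω; simp only [Z, Finset.sum_mul_sum, ind_and]
    rw [h3, expect_sum]
    have h4 : ∀ f ∈ P, expect m (fun ω => ∑ f' ∈ P, ind (I f ω ∧ I f' ω)) ≤ q + K * Q := by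
      intro f hf
      rw [expect_sum, ← Finset.add_sum_erase P _ hf]
      refine add_le_add ?_ ?_
      · rw [← h1 f hf]; exact le_of_eq (by simp only [and_self, prb])
      · refine (Finset.sum_le_sum fun f' hf' => h2 f hf f' (Finset.mem_of_mem_erase hf')
          (Finset.ne_of_mem_erase hf').symm).trans ?_
        rw [Finset.sum_const, nsmul_eq_mul, ← hPc]
        gcongr
        exact Finset.erase_subset _ _
    refine (Finset.sum_le_sum h4).trans ?_
    rw [Finset.sum_const, nsmul_eq_mul, hPc]; apply le_of_eq; ring
  have hmu : 0 < K * q := mul_pos hK0 hq0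
  -- Chebyshev's inequality
  have h5 : (K * q) ^ 2 * prb m (fun ω : Sym2 V → κ => PropD (labelGraph a ω))
      ≤ expect m (fun ω => Z ω * Z ω - (2 * (K * q)) * Z ω + (K * q) ^ 2) := by
    rw [prb, ← expect_const_mul]
    refine expect_mono hm0 fun ω => ?_
    have hsq : Z ω * Z ω - (2 * (K * q)) * Z ω + (K * q) ^ 2 = (Z ω - K * q) ^ 2 := by ring
    by_cases hD : PropD (labelGraph a ω)
    · have hZ0 : Z ω = 0 := Finset.sum_eq_zero fun f hf => ind_false fun hI => by
        obtain ⟨u, v, huv, rfl⟩ := Finset.card_eq_two.1 (hP f hf)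
        obtain ⟨w, hw1, hw2⟩ := propD_iff.1 hD u v huv (hI.1 u (by simp) v (by simp))
        have := hI.2
        rw [codeg, Finset.card_eq_zero, Finset.eq_empty_iff_forall_notMem] at this
        exact this w (mem_commonNbrs.2 (by simp [hw1, hw2]))
      rw [ind_true hD, hZ0]; simp
    · rw [ind_false hD, hsq, mul_zero]; positivity
  rw [expect_add, expect_sub, expect_const_mul, expect_const hm, hZ] at h5
  rw [← mul_le_mul_iff_right₀ (pow_pos hmu 2)]
  refine h5.trans ?_
  have h6 : (K * q) ^ 2 * (1 / (K * q) + (Q / q ^ 2 - 1)) = K * q + K * K * Q - (K * q) ^ 2 := by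
    field_simp
    ring
  rw [h6]
  nlinarith

end SingleGraph

/-! ### Moment estimates for the deterministic condition -/

section WellSpreadProbability

variable {V κ : Type*} [Fintype V] [DecidableEq V] [Fintype κ] {m : κ → ℝ} {a b : Set κ} {L : ℝ}

/-- The moment bound for configurations of bounded size, in terms of the mean `19 / 10 * L` of the
codegree in the graph of label set `a`: each of the pairs in `F` contributes the factor
`exp (- (1 - s) * (19 / 10) * L)`, as it would if the codegrees were independent Poisson
variables. -/
def MomentBound (V : Type*) [Fintype V] [DecidableEq V] (m : κ → ℝ) (a b : Set κ) (L : ℝ) : Prop :=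
  ∀ (V₀ : Finset V) (F : Finset (Finset V)) (H : Finset (Sym2 V)) (s : ℝ), 0 ≤ s → s ≤ 1 →
    (∀ f ∈ F, #f = 2 ∧ f ⊆ V₀) → (∀ e ∈ H, ∀ v ∈ e, v ∈ V₀) → #V₀ ≤ 14 → #F ≤ 12 →
    expect m (fun ω : Sym2 V → κ => ind (∀ e ∈ H, ω e ∈ b) *
        ∏ f ∈ F, s ^ codeg (labelGraph a ω) f)
      ≤ mass m b ^ #H * (3 * Real.exp (-((1 - s) * (19 / 10) * L * #F)))

/-- Two given pairs of vertices rarely both have small codegree: taking `s = 1 / 20` gives the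
exponent `2 * (1 - s) * (19 / 10) = 3.61`, which is what the union bounds over up to five vertices
need. -/
theorem prb_two_low_le (hm0 : ∀ k, 0 ≤ m k) (h : MomentBound V m a b L) {f f' : Finset V}
    (hf : #f = 2) (hf' : #f' = 2) (hne : f ≠ f') {V₀ : Finset V} (hV : f ∪ f' ⊆ V₀)
    (hV₀ : #V₀ ≤ 14) (H : Finset (Sym2 V)) (hH : ∀ e ∈ H, ∀ v ∈ e, v ∈ V₀) :
    prb m (fun ω : Sym2 V → κ => IsLow (labelGraph a ω) f ∧ IsLow (labelGraph a ω) f' ∧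
        ∀ e ∈ H, ω e ∈ b)
      ≤ 20 ^ 60 * (mass m b ^ #H * (3 * Real.exp (-(361 / 100 * L)))) := by
  have h1 := h V₀ {f, f'} H (1 / 20) (by norm_num) (by norm_num)
    (by simp [hf, hf', Finset.union_subset_iff.1 hV]) hH hV₀
    (by rw [Finset.card_pair hne]; norm_num)
  rw [Finset.card_pair hne] at h1
  have h2 : ((1 - 1 / 20) * (19 / 10) * L * (2 : ℕ) : ℝ) = 361 / 100 * L := by push_cast; ring
  rw [h2] at h1
  refine le_trans ?_ (mul_le_mul_of_nonneg_left h1 (by positivity))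
  rw [← expect_const_mul, prb]
  refine expect_mono hm0 fun ω => ?_
  simp only [Finset.prod_pair hne]
  by_cases hω : IsLow (labelGraph a ω) f ∧ IsLow (labelGraph a ω) f' ∧ ∀ e ∈ H, ω e ∈ b
  · rw [ind_true hω, ind_true hω.2.2, one_mul, ← pow_add]
    have h3 : ((1 / 20 : ℝ)) ^ 60
        ≤ (1 / 20) ^ (codeg (labelGraph a ω) f + codeg (labelGraph a ω) f') := by
      refine pow_le_pow_of_le_one (by norm_num) (by norm_num) ?_
      have := hω.1.codeg_le
      have := hω.2.1.codeg_le
      omega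
    calc (1 : ℝ) = 20 ^ 60 * (1 / 20) ^ 60 := by rw [← mul_pow]; norm_num
      _ ≤ _ := by gcongr
  · rw [ind_false hω]
    have := ind_nonneg (∀ e ∈ H, ω e ∈ b)
    positivity

theorem eq_of_pair_eq {W : Type*} [DecidableEq W] {z x x' : W} (hx : x ≠ z)
    (h : ({z, x} : Finset W) = {z, x'}) :
    x = x' := by
  have h1 : x ∈ ({z, x'} : Finset W) := h ▸ (by simp)
  simpa [hx] using h1

open Classical in
/-- The weight sum at a given pair `z`, `y` is rarely large. This is a bound on the twelfth
factorial moment; a moment of high order is needed to survive the union bound over `z` and `y`. -/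
theorem prb_sum_gt_le (hm0 : ∀ k, 0 ≤ m k) (h : MomentBound V m a b L) {z y : V} (hzy : z ≠ y) :
    prb m (fun ω : Sym2 V → κ => 1 / 1000 < ∑ x ∈ Finset.univ.filter
        (fun x => (labelGraph b ω).Adj y x ∧ x ≠ z),
        (3 / 5 : ℝ) ^ max 31 (codeg (labelGraph a ω) {z, x}))
      ≤ (2000 ^ 12 * (12).factorial) * (Fintype.card V ^ 12 *
          (mass m b ^ 12 * (3 * Real.exp (-(228 / 25 * L))))) := by
  let W : Finset (Finset V) := (Finset.univ.filter fun x => x ≠ y ∧ x ≠ z).powersetCard 12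
  have hW : (#W : ℝ) ≤ Fintype.card V ^ 12 := by
    have h1 : #W ≤ Fintype.card V ^ 12 := by
      rw [Finset.card_powersetCard]
      refine (Nat.choose_le_pow _ _).trans ?_
      exact Nat.pow_le_pow_left (Finset.card_le_univ _) _
    exact_mod_cast h1
  let T : Finset V → (Sym2 V → κ) → ℝ := fun S ω =>
    ind (∀ e ∈ S.image (fun x => s(y, x)), ω e ∈ b) *
      ∏ f ∈ S.image (fun x => ({z, x} : Finset V)), (3 / 5 : ℝ) ^ codeg (labelGraph a ω) f
  have hT0 : ∀ S ω, 0 ≤ T S ω := fun S ω =>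
    mul_nonneg (ind_nonneg _) (Finset.prod_nonneg fun _ _ => by positivity)
  have hT : ∀ S ∈ W, expect m (T S) ≤ mass m b ^ 12 * (3 * Real.exp (-(228 / 25 * L))) := by
    intro S hS
    obtain ⟨hS1, hS2⟩ := Finset.mem_powersetCard.1 hS
    have hS3 : ∀ x ∈ S, x ≠ y ∧ x ≠ z := fun x hx => (Finset.mem_filter.1 (hS1 hx)).2
    have hc1 : #(S.image (fun x => s(y, x))) = 12 := by
      rw [Finset.card_image_of_injective, hS2]
      exact fun x x' hx => Sym2.congr_right.1 hx
    have hc2 : #(S.image (fun x => ({z, x} : Finset V))) = 12 := by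
      rw [Finset.card_image_of_injOn, hS2]
      intro x hx x' _ hxx
      exact eq_of_pair_eq (hS3 x hx).2 hxx
    have h1 := h (insert z (insert y S)) (S.image (fun x => ({z, x} : Finset V)))
      (S.image (fun x => s(y, x))) (3 / 5) (by norm_num) (by norm_num)
      (by
        intro f hf
        obtain ⟨x, hx, rfl⟩ := Finset.mem_image.1 hf
        refine ⟨Finset.card_pair (hS3 x hx).2.symm, ?_⟩
        intro v hv
        simp only [Finset.mem_insert, Finset.mem_singleton] at hv ⊢
        rcases hv with rfl | rfl
        · exact Or.inl rfl
        · exact Or.inr (Or.inr hx))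
      (by
        intro e he v hv
        obtain ⟨x, hx, rfl⟩ := Finset.mem_image.1 he
        rw [Sym2.mem_iff] at hv
        simp only [Finset.mem_insert]
        rcases hv with rfl | rfl
        · exact Or.inr (Or.inl rfl)
        · exact Or.inr (Or.inr hx))
      (by
        refine (Finset.card_insert_le _ _).trans ?_
        have := Finset.card_insert_le y S
        omega)
      hc2.le
    rw [hc1, hc2] at h1
    have h2 : ((1 - 3 / 5) * (19 / 10) * L * (12 : ℕ) : ℝ) = 228 / 25 * L := by push_cast; ring
    rw [h2] at h1
    exact h1
  have key : prb m (fun ω : Sym2 V → κ => 1 / 1000 < ∑ x ∈ Finset.univ.filter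
        (fun x => (labelGraph b ω).Adj y x ∧ x ≠ z),
        (3 / 5 : ℝ) ^ max 31 (codeg (labelGraph a ω) {z, x}))
      ≤ expect m (fun ω => (2000 ^ 12 * (12).factorial) * ∑ S ∈ W, T S ω) := by
    refine prb_le_expect hm0 (fun ω => mul_nonneg (by positivity)
      (Finset.sum_nonneg fun S _ => hT0 S ω)) fun ω hω => ?_
    set X := Finset.univ.filter (fun x => (labelGraph b ω).Adj y x ∧ x ≠ z) with hX
    have h1 := pow_le_factorial_mul_sum_powersetCard X
      (fun x => (3 / 5 : ℝ) ^ max 31 (codeg (labelGraph a ω) {z, x})) (θ := 1 / 1000)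
      (η := 1 / 24000) (K := 12) (fun _ => by positivity)
      (fun x => (pow_le_pow_of_le_one (by norm_num) (by norm_num) (le_max_left 31 _)).trans
        (by norm_num)) (by norm_num) (by norm_num) hω.le 12 le_rfl
    have h2 : ∑ S ∈ X.powersetCard 12, ∏ x ∈ S,
        (3 / 5 : ℝ) ^ max 31 (codeg (labelGraph a ω) {z, x}) ≤ ∑ S ∈ W, T S ω := by
      have hsub : X.powersetCard 12 ⊆ W := Finset.powersetCard_mono fun x hx => by
        simp only [hX, Finset.mem_filter, Finset.mem_univ, true_and] at hx ⊢
        exact ⟨hx.1.ne', hx.2⟩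
      refine (Finset.sum_le_sum fun S hS => ?_).trans
        (Finset.sum_le_sum_of_subset_of_nonneg hsub fun S _ _ => hT0 S ω)
      have hS1 := (Finset.mem_powersetCard.1 hS).1
      have hS2 : ∀ x ∈ S, (labelGraph b ω).Adj y x ∧ x ≠ z := fun x hx =>
        (Finset.mem_filter.1 (hS1 hx)).2
      simp only [T]
      rw [ind_true, one_mul, Finset.prod_image]
      · exact Finset.prod_le_prod (fun _ _ => by positivity) fun x _ =>
          pow_le_pow_of_le_one (by norm_num) (by norm_num) (le_max_right _ _)
      · intro x hx x' _ hxx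
        exact eq_of_pair_eq (hS2 x hx).2 hxx
      · intro e he
        obtain ⟨x, hx, rfl⟩ := Finset.mem_image.1 he
        exact (labelGraph_adj.1 (hS2 x hx).1).1
    calc (1 : ℝ) = 2000 ^ 12 * (1 / 1000 - (12 : ℕ) * (1 / 24000)) ^ 12 := by norm_num
      _ ≤ 2000 ^ 12 * ((12).factorial * ∑ S ∈ X.powersetCard 12, ∏ x ∈ S,
          (3 / 5 : ℝ) ^ max 31 (codeg (labelGraph a ω) {z, x})) := by gcongr
      _ ≤ 2000 ^ 12 * ((12).factorial * ∑ S ∈ W, T S ω) := by gcongr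
      _ = _ := by ring
  refine key.trans ?_
  rw [expect_const_mul, expect_sum]
  refine mul_le_mul_of_nonneg_left ?_ (by positivity)
  refine (Finset.sum_le_sum hT).trans ?_
  rw [Finset.sum_const, nsmul_eq_mul]
  have := mass_nonneg hm0 b
  gcongr

/-- Union bound for the failure of the deterministic condition. -/
theorem prb_not_wellSpread_le (hm0 : ∀ k, 0 ≤ m k) (h : MomentBound V m a b L) {n : ℝ}
    (hn : (Fintype.card V : ℝ) = n) {q : ℝ} (hq : mass m b = q) :
    prb m (fun ω : Sym2 V → κ => ¬ WellSpread (labelGraph a ω) (labelGraph b ω))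
      ≤ n ^ 2 * ((2000 ^ 12 * (12).factorial) *
            (n ^ 12 * (q ^ 12 * (3 * Real.exp (-(228 / 25 * L))))))
        + (n ^ 3 * (20 ^ 60 * (q ^ 0 * (3 * Real.exp (-(361 / 100 * L)))))
        + (n ^ 4 * (20 ^ 60 * (q ^ 1 * (3 * Real.exp (-(361 / 100 * L)))))
        + n ^ 5 * (20 ^ 60 * (q ^ 4 * (3 * Real.exp (-(361 / 100 * L))))))) := by
  classical
  have hq0 : 0 ≤ q := hq ▸ mass_nonneg hm0 b
  have hn0 : 0 ≤ n := hn ▸ Nat.cast_nonneg _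
  let E₁ : V × V → (Sym2 V → κ) → Prop := fun i ω => i.1 ≠ i.2 ∧
    1 / 1000 < ∑ x ∈ Finset.univ.filter (fun x => (labelGraph b ω).Adj i.2 x ∧ x ≠ i.1),
        (3 / 5 : ℝ) ^ max 31 (codeg (labelGraph a ω) {i.1, x})
  let E₂ : V × V × V → (Sym2 V → κ) → Prop := fun i ω =>
    (i.1 ≠ i.2.1 ∧ i.1 ≠ i.2.2 ∧ i.2.1 ≠ i.2.2) ∧
    IsLow (labelGraph a ω) {i.1, i.2.1} ∧ IsLow (labelGraph a ω) {i.1, i.2.2} ∧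
      ∀ e ∈ (∅ : Finset (Sym2 V)), ω e ∈ b
  let E₃ : (V × V) × (V × V) → (Sym2 V → κ) → Prop := fun i ω =>
    (i.1.1 ≠ i.1.2 ∧ i.2.1 ≠ i.2.2 ∧
      Disjoint ({i.1.1, i.1.2} : Finset V) {i.2.1, i.2.2}) ∧
    IsLow (labelGraph a ω) {i.1.1, i.1.2} ∧ IsLow (labelGraph a ω) {i.2.1, i.2.2} ∧
      ∀ e ∈ ({s(i.1.1, i.2.1)} : Finset (Sym2 V)), ω e ∈ b
  let E₄ : V × (V × V) × (V × V) → (Sym2 V → κ) → Prop := fun i ω =>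
    (i.2.1.1 ≠ i.2.1.2 ∧ i.2.2.1 ≠ i.2.2.2 ∧
      Disjoint ({i.2.1.1, i.2.1.2} : Finset V) {i.2.2.1, i.2.2.2}) ∧
    IsLow (labelGraph a ω) {i.2.1.1, i.2.1.2} ∧ IsLow (labelGraph a ω) {i.2.2.1, i.2.2.2} ∧
      ∀ e ∈ (({i.2.1.1, i.2.1.2} : Finset V) ∪ {i.2.2.1, i.2.2.2}).image (fun x => s(i.1, x)),
        ω e ∈ b
  have hand : ∀ (c : Prop) (E : (Sym2 V → κ) → Prop) (B : ℝ), 0 ≤ B → (c → prb m E ≤ B) →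
      prb m (fun ω => c ∧ E ω) ≤ B := by
    intro c E B hB hcE
    by_cases hc : c
    · exact (prb_mono hm0 fun ω hω => hω.2).trans (hcE hc)
    · rw [prb_false fun ω hω => hc hω.1]; exact hB
  have h₁ := prb_exists_le hm0 Finset.univ E₁
    (B := (2000 ^ 12 * (12).factorial) * (n ^ 12 * (q ^ 12 * (3 * Real.exp (-(228 / 25 * L))))))
    fun i _ => hand _ _ _ (by positivity) fun hi => by
      have := prb_sum_gt_le hm0 h hi
      rw [hn, hq] at this
      convert this
  have h₂ := prb_exists_le hm0 Finset.univ E₂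
    (B := 20 ^ 60 * (q ^ 0 * (3 * Real.exp (-(361 / 100 * L)))))
    fun i _ => hand _ _ _ (by positivity) fun hi => by
      have := prb_two_low_le hm0 h (f := {i.1, i.2.1}) (f' := {i.1, i.2.2})
        (Finset.card_pair hi.1) (Finset.card_pair hi.2.1)
        (fun hff => hi.2.2 (eq_of_pair_eq hi.1.symm hff)) Finset.Subset.rfl
        ((Finset.card_union_le _ _).trans (by
          rw [Finset.card_pair hi.1, Finset.card_pair hi.2.1]; norm_num)) ∅ (by simp)
      rwa [hq, Finset.card_empty] at this
  have hne : ∀ {f f' : Finset V}, #f = 2 → Disjoint f f' → f ≠ f' := by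
    rintro f f' hf hd rfl
    rw [disjoint_self, Finset.bot_eq_empty] at hd
    rw [hd] at hf; simp at hf
  have h₃ := prb_exists_le hm0 Finset.univ E₃
    (B := 20 ^ 60 * (q ^ 1 * (3 * Real.exp (-(361 / 100 * L)))))
    fun i _ => hand _ _ _ (by positivity) fun hi => by
      have := prb_two_low_le hm0 h (f := {i.1.1, i.1.2}) (f' := {i.2.1, i.2.2})
        (Finset.card_pair hi.1) (Finset.card_pair hi.2.1)
        (hne (Finset.card_pair hi.1) hi.2.2) Finset.Subset.rfl
        ((Finset.card_union_le _ _).trans (by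
          rw [Finset.card_pair hi.1, Finset.card_pair hi.2.1]; norm_num))
        {s(i.1.1, i.2.1)} (by
          intro e he v hv
          rw [Finset.mem_singleton] at he
          subst he
          rw [Sym2.mem_iff] at hv
          rcases hv with rfl | rfl <;> simp)
      rwa [hq, Finset.card_singleton] at this
  have h₄ := prb_exists_le hm0 Finset.univ E₄
    (B := 20 ^ 60 * (q ^ 4 * (3 * Real.exp (-(361 / 100 * L)))))
    fun i _ => hand _ _ _ (by positivity) fun hi => by
      have hc : #(({i.2.1.1, i.2.1.2} : Finset V) ∪ {i.2.2.1, i.2.2.2}) = 4 := by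
        rw [Finset.card_union_of_disjoint hi.2.2, Finset.card_pair hi.1, Finset.card_pair hi.2.1]
      have := prb_two_low_le hm0 h (f := {i.2.1.1, i.2.1.2}) (f' := {i.2.2.1, i.2.2.2})
        (Finset.card_pair hi.1) (Finset.card_pair hi.2.1)
        (hne (Finset.card_pair hi.1) hi.2.2) (Finset.subset_insert i.1 _)
        ((Finset.card_insert_le _ _).trans (by rw [hc]; norm_num))
        ((({i.2.1.1, i.2.1.2} : Finset V) ∪ {i.2.2.1, i.2.2.2}).image (fun x => s(i.1, x))) (by
          intro e he v hv
          obtain ⟨x, hx, rfl⟩ := Finset.mem_image.1 he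
          rw [Sym2.mem_iff] at hv
          rcases hv with rfl | rfl
          · exact Finset.mem_insert_self _ _
          · exact Finset.mem_insert_of_mem hx)
      rwa [hq, Finset.card_image_of_injective _ (fun x x' hx => Sym2.congr_right.1 hx), hc] at this
  simp only [Finset.card_univ, Fintype.card_prod, Nat.cast_mul, hn] at h₁ h₂ h₃ h₄
  have hcover : ∀ ω : Sym2 V → κ, ¬ WellSpread (labelGraph a ω) (labelGraph b ω) →
      (∃ i ∈ Finset.univ, E₁ i ω) ∨ (∃ i ∈ Finset.univ, E₂ i ω) ∨
        (∃ i ∈ Finset.univ, E₃ i ω) ∨ (∃ i ∈ Finset.univ, E₄ i ω) := by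
    intro ω hω
    by_contra hcon
    simp only [not_or] at hcon
    obtain ⟨n₁, n₂, n₃, n₄⟩ := hcon
    refine hω ⟨fun z y hzy => ?_, fun f f' hf hf' hd => ?_, fun f f' hf hf' hd u hu v hv huv => ?_,
      fun u f f' hf hf' hd hu => ?_⟩
    · by_contra hlt
      rw [not_le] at hlt
      refine n₁ ⟨(z, y), Finset.mem_univ _, hzy, ?_⟩
      convert hlt
    · by_contra hff
      obtain ⟨z, hz, hz'⟩ := Finset.not_disjoint_iff.1 hd
      obtain ⟨x, hx, rfl⟩ := exists_pair_of_mem hf.card hz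
      obtain ⟨x', hx', rfl⟩ := exists_pair_of_mem hf'.card hz'
      exact n₂ ⟨(z, x, x'), Finset.mem_univ _,
        ⟨hx.symm, hx'.symm, fun hxx => hff (by simp only at hxx; rw [hxx])⟩, hf, hf', by simp⟩
    · obtain ⟨x, hx, rfl⟩ := exists_pair_of_mem hf.card hu
      obtain ⟨y, hy, rfl⟩ := exists_pair_of_mem hf'.card hv
      refine n₃ ⟨((u, x), (v, y)), Finset.mem_univ _, ⟨hx.symm, hy.symm, hd⟩, hf, hf', ?_⟩
      simpa using (labelGraph_adj.1 huv).1
    · obtain ⟨a', x, hx, rfl⟩ := Finset.card_eq_two.1 hf.card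
      obtain ⟨b', y, hy, rfl⟩ := Finset.card_eq_two.1 hf'.card
      refine n₄ ⟨(u, (a', x), (b', y)), Finset.mem_univ _, ⟨hx, hy, hd⟩, hf, hf', ?_⟩
      intro e he
      obtain ⟨w, hw, rfl⟩ := Finset.mem_image.1 he
      exact (labelGraph_adj.1 (hu w hw)).1
  refine (prb_mono hm0 hcover).trans ((prb_or_le hm0 _ _).trans (add_le_add ?_
    ((prb_or_le hm0 _ _).trans (add_le_add ?_ ((prb_or_le hm0 _ _).trans (add_le_add ?_ ?_))))))
  · exact h₁.trans (le_of_eq (by ring))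
  · exact h₂.trans (le_of_eq (by ring))
  · exact h₃.trans (le_of_eq (by ring))
  · exact h₄.trans (le_of_eq (by ring))

end WellSpreadProbability

/-! ### Explicit estimates and the choice of edge probabilities -/

section Estimates

/-- The error terms in `expect_edges_mul_codeg_le` are absorbed by the constant `3 > exp 1`. -/
theorem momentBound_of_le {V κ : Type*} [Fintype V] [DecidableEq V] [Fintype κ] {m : κ → ℝ}
    (hm0 : ∀ k, 0 ≤ m k) (hm : ∑ k, m k = 1) {a b : Set κ} {L p n : ℝ}
    (hn : (Fintype.card V : ℝ) = n) (hp : mass m a = p) (hL : n * p ^ 2 = 19 / 10 * L)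
    (hsmall : 168 * p ^ 2 + 144 * (n * p ^ 3) ≤ 1) : MomentBound V m a b L := by
  intro V₀ F H s hs0 hs1 hF hH hV₀ hFc
  have hp0 : 0 ≤ p := hp ▸ mass_nonneg hm0 a
  have hn0 : 0 ≤ n := hn ▸ Nat.cast_nonneg _
  refine (expect_edges_mul_codeg_le hm0 hm V₀ F hF H hH a b hs0 hs1).trans ?_
  refine mul_le_mul_of_nonneg_left ?_ (pow_nonneg (mass_nonneg hm0 b) _)
  rw [hp]
  have hf0 : (0 : ℝ) ≤ #F := Nat.cast_nonneg _
  have hf1 : (#F : ℝ) ≤ 12 := by exact_mod_cast hFc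
  have hv1 : (#V₀ : ℝ) ≤ 14 := by exact_mod_cast hV₀
  have hv0 : (0 : ℝ) ≤ #V₀ := Nat.cast_nonneg _
  obtain ⟨f, hf⟩ : ∃ f : ℝ, (#F : ℝ) = f := ⟨_, rfl⟩
  obtain ⟨v, hv⟩ : ∃ v : ℝ, (#V₀ : ℝ) = v := ⟨_, rfl⟩
  rw [hf] at hf0 hf1 ⊢
  rw [hv] at hv0 hv1
  have hp3 : 0 ≤ p ^ 3 := pow_nonneg hp0 3
  have hp2 : 0 ≤ p ^ 2 := pow_nonneg hp0 2
  have hnp3 : 0 ≤ n * p ^ 3 := mul_nonneg hn0 hp3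
  have hf2 : f ^ 2 ≤ 144 := by nlinarith
  have hfv : f * v ≤ 168 := by nlinarith
  have hbase : 0 ≤ 1 - (1 - s) * (f * p ^ 2 - f ^ 2 * p ^ 3) := by
    have h1 : f * p ^ 2 - f ^ 2 * p ^ 3 ≤ 1 := by
      have : 0 ≤ f ^ 2 * p ^ 3 := by positivity
      nlinarith
    have h2 : (1 - s) * (f * p ^ 2 - f ^ 2 * p ^ 3) ≤ (1 - s) * 1 :=
      mul_le_mul_of_nonneg_left h1 (by linarith)
    linarith
  have hexp : 1 - (1 - s) * (f * p ^ 2 - f ^ 2 * p ^ 3)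
      ≤ Real.exp (-((1 - s) * (f * p ^ 2 - f ^ 2 * p ^ 3))) := by
    have := Real.add_one_le_exp (-((1 - s) * (f * p ^ 2 - f ^ 2 * p ^ 3)))
    linarith
  refine (pow_le_pow_left₀ hbase hexp _).trans ?_
  rw [← Real.exp_nat_mul, Nat.cast_sub (Finset.card_le_univ V₀), hn, hv]
  have h3 : Real.exp 1 ≤ 3 := by have := Real.exp_one_lt_d9; linarith
  refine le_trans (b := Real.exp 1 * Real.exp (-((1 - s) * (19 / 10) * L * f))) ?_
    (mul_le_mul_of_nonneg_right h3 (Real.exp_pos _).le)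
  rw [← Real.exp_add, Real.exp_le_exp]
  have h4 : (n - v) * -((1 - s) * (f * p ^ 2 - f ^ 2 * p ^ 3))
      = (1 - s) * (f * v * p ^ 2 + f ^ 2 * (n * p ^ 3) - v * f ^ 2 * p ^ 3 - f * (n * p ^ 2)) := by
    ring
  rw [h4, hL]
  have h5 : f * v * p ^ 2 ≤ 168 * p ^ 2 := mul_le_mul_of_nonneg_right hfv hp2
  have h6 : f ^ 2 * (n * p ^ 3) ≤ 144 * (n * p ^ 3) := mul_le_mul_of_nonneg_right hf2 hnp3
  have h7 : 0 ≤ v * f ^ 2 * p ^ 3 := by positivity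
  have h8 : (1 - s) * (f * v * p ^ 2 + f ^ 2 * (n * p ^ 3) - v * f ^ 2 * p ^ 3) ≤ 1 := by
    have h9 : f * v * p ^ 2 + f ^ 2 * (n * p ^ 3) - v * f ^ 2 * p ^ 3 ≤ 1 := by linarith
    have h10 := mul_le_mul_of_nonneg_left h9 (sub_nonneg.2 hs1)
    linarith
  linarith

theorem exp_neg_le_one_sub {x : ℝ} (h0 : 0 ≤ x) (h1 : x ≤ 1 / 2) :
    Real.exp (-(x + 2 * x ^ 2)) ≤ 1 - x := by
  rw [Real.exp_neg, inv_le_comm₀ (Real.exp_pos _) (by linarith)]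
  refine le_trans ?_ (Real.add_one_le_exp _)
  rw [inv_le_iff_one_le_mul₀ (by linarith)]
  nlinarith [mul_nonneg (pow_nonneg h0 2) (by linarith : (0 : ℝ) ≤ 1 - 2 * x)]

/-- The second moment bound near the threshold: the expected number of non-adjacent pairs without
common neighbours has order `n ^ 2 * exp (- n * p ^ 2)`, and the ratio of the probabilities for two
pairs and for one pair squared is close to one. -/
theorem prb_propD_le_explicit {V κ : Type*} [Fintype V] [DecidableEq V] [Fintype κ] {m : κ → ℝ}
    (hm0 : ∀ k, 0 ≤ m k) (hm : ∑ k, m k = 1) {a : Set κ} {L p n : ℝ}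
    (hn : (Fintype.card V : ℝ) = n) (hn4 : 4 ≤ n) (hp : mass m a = p) (hp2 : p ≤ 1 / 2)
    (hL : n * p ^ 2 = 19 / 10 * L) (hsmall : 2 * (n * p ^ 3) ≤ 1) :
    prb m (fun ω : Sym2 V → κ => PropD (labelGraph a ω))
      ≤ 24 * (Real.exp (19 / 10 * L) / n ^ 2)
        + (Real.exp (16 * (n * p ^ 3)) / ((1 - p) ^ 2 * (1 - p ^ 2) ^ 4) - 1) := by
  have hp0 : 0 ≤ p := hp ▸ mass_nonneg hm0 a
  have hn0 : 0 < n := by linarith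
  obtain ⟨N, hN⟩ : ∃ N, Fintype.card V = N + 4 := by
    have : 4 ≤ Fintype.card V := by exact_mod_cast (hn ▸ hn4 : (4 : ℝ) ≤ Fintype.card V)
    exact ⟨_, (Nat.sub_add_cancel this).symm⟩
  have hNn : (N : ℝ) + 4 = n := by rw [← hn, hN]; push_cast; ring
  have hsq : p ^ 2 ≤ 1 / 4 := by nlinarith
  have hx0 : 0 < 1 - p ^ 2 := by linarith
  have hp30 : 0 ≤ p ^ 3 := by positivity
  have hK : ((Fintype.card V).choose 2 : ℝ) = n * (n - 1) / 2 := by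
    rw [Nat.cast_choose_two, hn]
  have hq0 : 0 < (1 - p) * (1 - p ^ 2) ^ (Fintype.card V - 2) :=
    mul_pos (by linarith) (pow_pos hx0 _)
  have hK0 : 0 < n * (n - 1) / 2 := by nlinarith
  refine (prb_propD_le hm0 hm a hp hp2 rfl hq0 rfl hK hK0).trans (add_le_add ?_ ?_)
  · have h1 : Real.exp (-(19 / 10 * L)) / 6
        ≤ (1 - p) * (1 - p ^ 2) ^ (Fintype.card V - 2) := by
      have h2 := pow_le_pow_left₀ (Real.exp_pos _).le
        (exp_neg_le_one_sub (x := p ^ 2) (by positivity) (by linarith)) (Fintype.card V - 2)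
      rw [← Real.exp_nat_mul] at h2
      have h3 : Real.exp (-(19 / 10 * L)) * Real.exp (-1) ≤ Real.exp
          ((Fintype.card V - 2 : ℕ) * -(p ^ 2 + 2 * (p ^ 2) ^ 2)) := by
        rw [← Real.exp_add, Real.exp_le_exp, ← hL]
        have h4 : ((Fintype.card V - 2 : ℕ) : ℝ) ≤ n := by
          rw [← hn]; exact_mod_cast Nat.sub_le _ _
        have h5 : 0 ≤ p ^ 2 + 2 * (p ^ 2) ^ 2 := by positivity
        have h6 := mul_le_mul_of_nonneg_right h4 h5
        have h7 : n * (2 * (p ^ 2) ^ 2) ≤ 1 := by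
          have : n * (2 * (p ^ 2) ^ 2) = 2 * (n * p ^ 3) * p := by ring
          rw [this]
          have : 0 ≤ 2 * (n * p ^ 3) := by positivity
          nlinarith
        linarith
      have h4 : (1 / 3 : ℝ) ≤ Real.exp (-1) := by
        rw [Real.exp_neg, one_div]
        exact inv_anti₀ (Real.exp_pos 1) (by have := Real.exp_one_lt_d9; linarith)
      have h5 := Real.exp_pos (-(19 / 10 * L))
      calc Real.exp (-(19 / 10 * L)) / 6
          = (1 / 2) * (Real.exp (-(19 / 10 * L)) * (1 / 3)) := by ring
        _ ≤ (1 / 2) * (Real.exp (-(19 / 10 * L)) * Real.exp (-1)) := by gcongr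
        _ ≤ (1 - p) * (1 - p ^ 2) ^ (Fintype.card V - 2) :=
          mul_le_mul (by linarith) (h3.trans h2) (by positivity) (by linarith)
    have h2 : n ^ 2 / 4 ≤ n * (n - 1) / 2 := by nlinarith
    have h3 : n ^ 2 / 4 * (Real.exp (-(19 / 10 * L)) / 6)
        ≤ n * (n - 1) / 2 * ((1 - p) * (1 - p ^ 2) ^ (Fintype.card V - 2)) :=
      mul_le_mul h2 h1 (by positivity) hK0.le
    refine (one_div_le_one_div_of_le (by positivity) h3).trans (le_of_eq ?_)
    rw [Real.exp_neg]; field_simp; norm_num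
  · have e1 : Fintype.card V - 2 = N + 2 := by omega
    have e2 : Fintype.card V - 4 = N := by omega
    rw [e1, e2]
    have h1 : (1 - (2 * p ^ 2 - 4 * p ^ 3)) ≤ (1 - p ^ 2) ^ 2 * Real.exp (16 * p ^ 3) := by
      have h2 := Real.add_one_le_exp (16 * p ^ 3)
      have h3 : (1 - p ^ 2) ^ 2 * (16 * p ^ 3 + 1) ≤ (1 - p ^ 2) ^ 2 * Real.exp (16 * p ^ 3) :=
        mul_le_mul_of_nonneg_left h2 (by positivity)
      have h4 : (9 / 16 : ℝ) ≤ (1 - p ^ 2) ^ 2 := by nlinarith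
      have h5 := mul_le_mul_of_nonneg_right h4 hp30
      nlinarith [sq_nonneg (p ^ 2)]
    have hb0 : 0 ≤ 1 - (2 * p ^ 2 - 4 * p ^ 3) := by nlinarith
    have h2 : (1 - (2 * p ^ 2 - 4 * p ^ 3)) ^ N
        ≤ ((1 - p ^ 2) ^ N) ^ 2 * Real.exp (16 * (n * p ^ 3)) := by
      refine (pow_le_pow_left₀ hb0 h1 N).trans ?_
      rw [mul_pow, ← pow_mul, ← pow_mul, mul_comm 2 N, ← Real.exp_nat_mul]
      refine mul_le_mul_of_nonneg_left (Real.exp_le_exp.2 ?_) (by positivity)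
      nlinarith
    refine sub_le_sub_right ?_ 1
    have h3 : 0 < 1 - p := by linarith
    rw [div_le_div_iff₀ (by positivity) (by positivity)]
    calc (1 - (2 * p ^ 2 - 4 * p ^ 3)) ^ N * ((1 - p) ^ 2 * (1 - p ^ 2) ^ 4)
        ≤ (((1 - p ^ 2) ^ N) ^ 2 * Real.exp (16 * (n * p ^ 3))) *
            ((1 - p) ^ 2 * (1 - p ^ 2) ^ 4) := by gcongr
      _ = _ := by ring

theorem prb_not_propD_le_explicit {V κ : Type*} [Fintype V] [DecidableEq V] [Fintype κ]
    {m : κ → ℝ} (hm0 : ∀ k, 0 ≤ m k) (hm : ∑ k, m k = 1) {a : Set κ} {p n : ℝ}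
    (hn : (Fintype.card V : ℝ) = n) (hn4 : 4 ≤ n) (hp : mass m a = p) (hp2 : p ≤ 1 / 2) :
    prb m (fun ω : Sym2 V → κ => ¬ PropD (labelGraph a ω))
      ≤ n ^ 2 * Real.exp (-(n * p ^ 2 / 4)) := by
  have hp0 : 0 ≤ p := hp ▸ mass_nonneg hm0 a
  refine (prb_not_propD_le hm0 hm a).trans ?_
  rw [hp, Nat.cast_choose_two, hn]
  have hc : 2 ≤ Fintype.card V := by
    have : (2 : ℝ) ≤ Fintype.card V := by linarith
    exact_mod_cast this
  have hp3 : p ^ 3 ≤ p ^ 2 / 2 := by nlinarith [pow_nonneg hp0 2]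
  have hsq : p ^ 2 ≤ 1 / 4 := by nlinarith
  have h1 : (1 - (p ^ 2 - p ^ 3)) ^ (Fintype.card V - 2) ≤ Real.exp (-(n * p ^ 2 / 4)) := by
    have h2 : 1 - (p ^ 2 - p ^ 3) ≤ Real.exp (-(p ^ 2 / 2)) := by
      have := Real.add_one_le_exp (-(p ^ 2 / 2))
      linarith
    refine (pow_le_pow_left₀ (by have := pow_nonneg hp0 3; linarith) h2 _).trans ?_
    rw [← Real.exp_nat_mul, Real.exp_le_exp, Nat.cast_sub hc, hn]
    push_cast
    nlinarith [pow_nonneg hp0 2]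
  refine mul_le_mul (by nlinarith) h1 (pow_nonneg ?_ _) (by positivity)
  have := pow_nonneg hp0 3; linarith

end Estimates

section Limits

/-- The weights of three labels whose probabilities are `p`, `q - p` and `1 - q`. -/
def weights (p q : ℝ) : Fin 3 → ℝ := ![p, q - p, 1 - q]

theorem weights_nonneg {p q : ℝ} (h0 : 0 ≤ p) (h1 : p ≤ q) (h2 : q ≤ 1) (k : Fin 3) :
    0 ≤ weights p q k := by
  fin_cases k <;> simp [weights, h0, h1, h2]

theorem sum_weights (p q : ℝ) : ∑ k, weights p q k = 1 := by
  simp [weights, Fin.sum_univ_three]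

theorem mass_weights_zero (p q : ℝ) : mass (weights p q) {0} = p := by
  simp [mass, weights, ind]

theorem mass_weights_zero_one (p q : ℝ) : mass (weights p q) {0, 1} = q := by
  simp [mass, weights, Fin.sum_univ_three, ind]

/-- An edge probability slightly below the threshold `√(2 log n / n)` for diameter two. The
constant `19 / 10` is large enough for two pairs of small codegree joined by an edge not to occur,
as `4 - 12 / 25 < 2 * (19 / 20) * (19 / 10)`. -/
def lowerProb (n : ℕ) : ℝ := √(19 / 10 * Real.log n / n)

/-- An edge probability well above the threshold for diameter two. -/
def upperProb (n : ℕ) : ℝ := (n : ℝ) ^ (-(12 / 25) : ℝ)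

theorem lowerProb_nonneg (n : ℕ) : 0 ≤ lowerProb n := Real.sqrt_nonneg _

theorem upperProb_nonneg (n : ℕ) : 0 ≤ upperProb n := by unfold upperProb; positivity

theorem mul_lowerProb_sq (n : ℕ) : n * lowerProb n ^ 2 = 19 / 10 * Real.log n := by
  rcases Nat.eq_zero_or_pos n with rfl | hn
  · simp
  · have : (0 : ℝ) < n := by exact_mod_cast hn
    rw [lowerProb, Real.sq_sqrt (by have := Real.log_natCast_nonneg n; positivity)]
    field_simp

theorem tendsto_upperProb : Tendsto upperProb atTop (𝓝 0) :=
  (tendsto_rpow_neg_atTop (by norm_num : (0 : ℝ) < 12 / 25)).comp tendsto_natCast_atTop_atTop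

theorem eventually_lowerProb_le : ∀ᶠ n in atTop, lowerProb n ≤ upperProb n := by
  have h := (isLittleO_log_rpow_atTop (by norm_num : (0 : ℝ) < 1 / 25)).def
    (by norm_num : (0 : ℝ) < 1 / 2)
  filter_upwards [tendsto_natCast_atTop_atTop.eventually h, eventually_gt_atTop 0] with n hn hn0
  have hn1 : (0 : ℝ) < n := by exact_mod_cast hn0
  rw [Real.norm_of_nonneg (Real.log_natCast_nonneg n), Real.norm_of_nonneg (by positivity)] at hn
  rw [lowerProb, Real.sqrt_le_left (upperProb_nonneg n), upperProb, ← Real.rpow_natCast,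
    ← Real.rpow_mul hn1.le, div_le_iff₀ hn1]
  nth_rewrite 3 [← Real.rpow_one (n : ℝ)]
  rw [← Real.rpow_add hn1]
  have : (0 : ℝ) ≤ (n : ℝ) ^ (1 / 25 : ℝ) := by positivity
  norm_num at hn this ⊢
  linarith

theorem tendsto_lowerProb : Tendsto lowerProb atTop (𝓝 0) :=
  squeeze_zero' (Eventually.of_forall lowerProb_nonneg) eventually_lowerProb_le tendsto_upperProb

theorem tendsto_mul_lowerProb_pow : Tendsto (fun n : ℕ => n * lowerProb n ^ 3) atTop (𝓝 0) := by
  have h := (isLittleO_log_rpow_atTop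
    (by norm_num : (0 : ℝ) < 12 / 25)).tendsto_div_nhds_zero.comp tendsto_natCast_atTop_atTop
  have h2 := h.const_mul (19 / 10)
  rw [mul_zero] at h2
  refine squeeze_zero' (Eventually.of_forall fun n => ?_) ?_ h2
  · have := lowerProb_nonneg n; positivity
  · filter_upwards [eventually_lowerProb_le] with n hn
    have h3 : n * lowerProb n ^ 3 = 19 / 10 * Real.log n * lowerProb n := by
      rw [← mul_lowerProb_sq]; ring
    rw [h3]
    have h4 : upperProb n = ((n : ℝ) ^ (12 / 25 : ℝ))⁻¹ := by
      rw [upperProb, Real.rpow_neg (Nat.cast_nonneg n)]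
    have := Real.log_natCast_nonneg n
    calc 19 / 10 * Real.log n * lowerProb n ≤ 19 / 10 * Real.log n * upperProb n := by gcongr
      _ = _ := by rw [h4]; simp only [Function.comp_apply]; ring

theorem tendsto_const_mul_rpow_mul {C e : ℝ} (he : e < 0) {φ : ℕ → ℝ}
    (hφ : ∀ n : ℕ, 0 < n → φ n = C * (n : ℝ) ^ e) : Tendsto φ atTop (𝓝 0) := by
  have h := ((tendsto_rpow_neg_atTop (neg_pos.2 he)).comp tendsto_natCast_atTop_atTop).const_mul C
  rw [mul_zero, neg_neg] at h
  refine h.congr' ?_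
  filter_upwards [eventually_gt_atTop 0] with n hn
  exact (hφ n hn).symm

theorem pow_mul_upperProb_pow_mul_exp {n : ℕ} (hn : 0 < n) (k j : ℕ) (c : ℝ) :
    (n : ℝ) ^ k * (upperProb n ^ j * Real.exp (-(c * Real.log n)))
      = (n : ℝ) ^ ((k : ℝ) - 12 / 25 * j - c) := by
  have hn1 : (0 : ℝ) < n := by exact_mod_cast hn
  have h1 : Real.exp (-(c * Real.log n)) = (n : ℝ) ^ (-c) := by
    rw [Real.rpow_def_of_pos hn1]; congr 1; ring
  rw [h1, upperProb, ← Real.rpow_natCast (_ ^ _) j, ← Real.rpow_mul hn1.le, ← Real.rpow_natCast _ k,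
    ← Real.rpow_add hn1, ← Real.rpow_add hn1]
  congr 1; ring

end Limits

/-! ### Limits and hitting times -/

section Limits

/-- The label weights for `n` vertices. -/
def labelWeights (n : ℕ) : Fin 3 → ℝ := weights (lowerProb n) (upperProb n)

theorem sum_labelWeights (n : ℕ) : ∑ k, labelWeights n k = 1 := sum_weights _ _

theorem eventually_labelWeights_nonneg : ∀ᶠ n in atTop, ∀ k, 0 ≤ labelWeights n k := by
  filter_upwards [eventually_lowerProb_le,
    tendsto_upperProb.eventually_le_const (by norm_num : (0 : ℝ) < 1)] with n h1 h2
  exact weights_nonneg (lowerProb_nonneg n) h1 h2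

theorem tendsto_prb_propD : Tendsto (fun n => prb (labelWeights n)
    (fun ω : Sym2 (Fin n) → Fin 3 => PropD (labelGraph {0} ω))) atTop (𝓝 0) := by
  have h1 : Tendsto (fun n : ℕ => 24 * (Real.exp (19 / 10 * Real.log n) / (n : ℝ) ^ 2)) atTop
      (𝓝 0) := by
    refine tendsto_const_mul_rpow_mul (C := 24) (e := -(1 / 10)) (by norm_num) fun n hn => ?_
    have hn1 : (0 : ℝ) < n := by exact_mod_cast hn
    have h2 : Real.exp (19 / 10 * Real.log n) = (n : ℝ) ^ (19 / 10 : ℝ) := by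
      rw [Real.rpow_def_of_pos hn1]; congr 1; ring
    rw [h2, ← Real.rpow_natCast, ← Real.rpow_sub hn1]
    norm_num
  have h2 : Tendsto (fun n : ℕ => Real.exp (16 * (n * lowerProb n ^ 3)) /
      ((1 - lowerProb n) ^ 2 * (1 - lowerProb n ^ 2) ^ 4) - 1) atTop (𝓝 0) := by
    have h3 : Tendsto (fun n : ℕ => Real.exp (16 * (n * lowerProb n ^ 3))) atTop
        (𝓝 (Real.exp (16 * 0))) :=
      (Real.continuous_exp.tendsto _).comp (tendsto_mul_lowerProb_pow.const_mul 16)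
    have h4 : Tendsto (fun n : ℕ => (1 - lowerProb n) ^ 2 * (1 - lowerProb n ^ 2) ^ 4) atTop
        (𝓝 ((1 - 0) ^ 2 * (1 - 0 ^ 2) ^ 4)) :=
      ((tendsto_lowerProb.const_sub 1).pow 2).mul (((tendsto_lowerProb.pow 2).const_sub 1).pow 4)
    have h5 := (h3.div h4 (by norm_num)).sub_const 1
    simpa using h5
  have h3 := h1.add h2
  rw [add_zero] at h3
  refine squeeze_zero' ?_ ?_ h3
  · filter_upwards [eventually_labelWeights_nonneg] with n hn
    exact prb_nonneg hn _
  · filter_upwards [eventually_labelWeights_nonneg, eventually_ge_atTop 4,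
      tendsto_lowerProb.eventually_le_const (by norm_num : (0 : ℝ) < 1 / 2),
      tendsto_mul_lowerProb_pow.eventually_le_const (by norm_num : (0 : ℝ) < 1 / 2)]
      with n hn hn4 hp hp3
    exact prb_propD_le_explicit hn (sum_labelWeights n) (by simp) (by exact_mod_cast hn4)
      (mass_weights_zero _ _) hp (mul_lowerProb_sq n) (by linarith)

theorem tendsto_prb_not_propD : Tendsto (fun n => prb (labelWeights n)
    (fun ω : Sym2 (Fin n) → Fin 3 => ¬ PropD (labelGraph {0, 1} ω))) atTop (𝓝 0) := by
  have h1 : Tendsto (fun n : ℕ => (n : ℝ) ^ 2 * Real.exp (-(n * upperProb n ^ 2 / 4))) atTop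
      (𝓝 0) := by
    -- with `x = n ^ (1 / 25) / 4` the expression is `4 ^ 50 * x ^ 50 * exp (-x)`
    have h2 : Tendsto (fun n : ℕ => (n : ℝ) ^ (1 / 25 : ℝ) / 4) atTop atTop :=
      ((tendsto_rpow_atTop (by norm_num)).comp tendsto_natCast_atTop_atTop).atTop_div_const
        (by norm_num)
    have h3 := ((Real.tendsto_pow_mul_exp_neg_atTop_nhds_zero 50).comp h2).const_mul (4 ^ 50)
    rw [mul_zero] at h3
    refine h3.congr' ?_
    filter_upwards [eventually_gt_atTop 0] with n hn
    have hn1 : (0 : ℝ) < n := by exact_mod_cast hn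
    have h4 : (n : ℝ) * upperProb n ^ 2 = (n : ℝ) ^ (1 / 25 : ℝ) := by
      rw [upperProb, ← Real.rpow_natCast, ← Real.rpow_mul hn1.le]
      nth_rewrite 1 [← Real.rpow_one (n : ℝ)]
      rw [← Real.rpow_add hn1]; norm_num
    have h5 : ((n : ℝ) ^ (1 / 25 : ℝ)) ^ 50 = (n : ℝ) ^ 2 := by
      rw [← Real.rpow_natCast, ← Real.rpow_mul hn1.le, ← Real.rpow_natCast]; norm_num
    simp only [Function.comp_apply]
    rw [h4, div_pow, h5]
    ring
  refine squeeze_zero' ?_ ?_ h1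
  · filter_upwards [eventually_labelWeights_nonneg] with n hn
    exact prb_nonneg hn _
  · filter_upwards [eventually_labelWeights_nonneg, eventually_ge_atTop 4,
      tendsto_upperProb.eventually_le_const (by norm_num : (0 : ℝ) < 1 / 2)] with n hn hn4 hp
    exact prb_not_propD_le_explicit hn (sum_labelWeights n) (by simp) (by exact_mod_cast hn4)
      (mass_weights_zero_one _ _) hp

theorem tendsto_prb_not_wellSpread : Tendsto (fun n => prb (labelWeights n)
    (fun ω : Sym2 (Fin n) → Fin 3 => ¬ WellSpread (labelGraph {0} ω) (labelGraph {0, 1} ω)))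
    atTop (𝓝 0) := by
  have h1 : Tendsto (fun n : ℕ => (n : ℝ) ^ 2 * ((2000 ^ 12 * (12).factorial) *
      ((n : ℝ) ^ 12 * (upperProb n ^ 12 * (3 * Real.exp (-(228 / 25 * Real.log n)))))))
      atTop (𝓝 0) := by
    refine tendsto_const_mul_rpow_mul (C := 2000 ^ 12 * (12).factorial * 3)
      (e := (14 : ℕ) - 12 / 25 * (12 : ℕ) - 228 / 25) (by norm_num) fun n hn => ?_
    rw [← pow_mul_upperProb_pow_mul_exp hn 14 12 (228 / 25)]
    ring
  have h2 : ∀ k j : ℕ, (k : ℝ) - 12 / 25 * j - 361 / 100 < 0 → Tendsto (fun n : ℕ =>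
      (n : ℝ) ^ k * (20 ^ 60 * (upperProb n ^ j * (3 * Real.exp (-(361 / 100 * Real.log n))))))
      atTop (𝓝 0) := by
    intro k j hkj
    refine tendsto_const_mul_rpow_mul (C := 20 ^ 60 * 3) hkj fun n hn => ?_
    rw [← pow_mul_upperProb_pow_mul_exp hn k j (361 / 100)]
    ring
  have h3 := h1.add ((h2 3 0 (by norm_num)).add
    ((h2 4 1 (by norm_num)).add (h2 5 4 (by norm_num))))
  simp only [add_zero] at h3
  refine squeeze_zero' ?_ ?_ h3
  · filter_upwards [eventually_labelWeights_nonneg] with n hn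
    exact prb_nonneg hn _
  · have h4 := (tendsto_lowerProb.pow 2).const_mul 168
    have h5 := h4.add (tendsto_mul_lowerProb_pow.const_mul 144)
    filter_upwards [eventually_labelWeights_nonneg,
      h5.eventually_le_const (by norm_num : (168 * 0 ^ 2 + 144 * 0 : ℝ) < 1)] with n hn hsmall
    exact prb_not_wellSpread_le hn (momentBound_of_le hn (sum_labelWeights n) (by simp)
      (mass_weights_zero _ _) (mul_lowerProb_sq n) hsmall) (by simp) (mass_weights_zero_one _ _)

end Limits

section HittingTimes

variable {V : Type*} [Fintype V] [DecidableEq V]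

/-- The hitting times coincide if the trajectory is suitably trapped: `PropD` is first satisfied
after `t₁` and no later than `t₂`, and at that time `PropR` holds as well. -/
theorem hittingTime_eq {N : ℕ} {g : Fin (N + 1) → SimpleGraph V} (hg : Monotone g)
    {t₁ t₂ : Fin (N + 1)} (h₁ : ¬ PropD (g t₁)) (h₂ : PropD (g t₂))
    (h : WellSpread (g t₁) (g t₂)) : hittingTime PropD g = hittingTime PropR g := by
  refine le_antisymm (le_iInf₂ fun t ht => iInf₂_le t ht.propD) ?_
  obtain ⟨t, ht, hmin⟩ := WellFounded.has_min (wellFounded_lt (α := Fin (N + 1)))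
    {t | PropD (g t)} ⟨t₂, h₂⟩
  have hmin' : ∀ s, PropD (g s) → t ≤ s := fun s hs => not_lt.1 (hmin s hs)
  have ht₁ : t₁ ≤ t := by
    by_contra hlt
    exact h₁ (PropD.mono (hg (not_le.1 hlt).le) ht)
  have htR : PropR (g t) := h.propR (hg ht₁) (hg (hmin' t₂ h₂)) ht
  exact le_iInf₂ fun s hs => (iInf₂_le t htR).trans (by exact_mod_cast hmin' s hs)

theorem ncard_edgeSet_le (G : SimpleGraph V) :
    G.edgeSet.ncard ≤ (Fintype.card V).choose 2 := by
  rw [← ncard_edgeSet_top]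
  exact Set.ncard_le_ncard (SimpleGraph.edgeSet_subset_edgeSet.2 le_top) (Set.toFinite _)

theorem le_prb_and {ι κ : Type*} [Fintype ι] [DecidableEq ι] [Fintype κ] {m : κ → ℝ}
    (hm0 : ∀ k, 0 ≤ m k) (hm : ∑ k, m k = 1) {E F : (ι → κ) → Prop} {α β : ℝ}
    (hE : α ≤ prb m E) (hF : β ≤ prb m F) :
    α + β - 1 ≤ prb m (fun ω => E ω ∧ F ω) := by
  have h1 := prb_not_and (m := m) E F
  have h2 := prb_mono (m := m) hm0 (E := fun ω => ¬ E ω ∧ F ω) (F := fun ω => ¬ E ω)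
    fun ω h => h.1
  rw [prb_not hm] at h2
  linarith

/-- The probability that the two hitting times coincide, in terms of the labelled random graph.
The times `t₁` and `t₂` are quantiles of the numbers of edges of the two binomial random graphs. -/
theorem one_le_prob_add {m : Fin 3 → ℝ} (hm0 : ∀ k, 0 ≤ m k) (hm : ∑ k, m k = 1) :
    1 ≤ prob (processLaw V ((Fintype.card V).choose 2))
        {g | hittingTime PropD g = hittingTime PropR g}
      + (ENNReal.ofReal
          (prb m (fun ω : Sym2 V → Fin 3 => PropD (labelGraph {0} ω)) / (1 / 4))
      + (ENNReal.ofReal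
          (prb m (fun ω : Sym2 V → Fin 3 => ¬ PropD (labelGraph {0, 1} ω)) / (1 / 4))
      + ENNReal.ofReal (prb m (fun ω : Sym2 V → Fin 3 =>
          ¬ WellSpread (labelGraph {0} ω) (labelGraph {0, 1} ω)) / (1 / 2)))) := by
  set N := (Fintype.card V).choose 2 with hN
  obtain ⟨t₁, ht₁, hle₁, hge₁⟩ := exists_quantile hm
    (fun ω : Sym2 V → Fin 3 => (labelGraph {0} ω).edgeSet.ncard)
    (fun ω => ncard_edgeSet_le _) (α := 3 / 4) (by norm_num) (by norm_num)
  obtain ⟨t₂, ht₂, hle₂, hge₂⟩ := exists_quantile hm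
    (fun ω : Sym2 V → Fin 3 => (labelGraph {0, 1} ω).edgeSet.ncard)
    (fun ω => ncard_edgeSet_le _) (α := 1 / 4) (by norm_num) (by norm_num)
  let s₁ : Fin (N + 1) := ⟨t₁, Nat.lt_succ_of_le ht₁⟩
  let s₂ : Fin (N + 1) := ⟨t₂, Nat.lt_succ_of_le ht₂⟩
  have hB₁ := prob_process_le (V := V) (t := N) (t₁ := s₁) (t₂ := s₁) (c := 1 / 4) (a := ∅)
    (b := {0}) hm0 (E := fun _ G => PropD G) (fun _ _ _ _ _ h hD => hD.mono h) (by simp) le_rfl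
    le_rfl (by norm_num) (by
      refine le_trans (by norm_num) (hge₁.trans (prb_mono hm0 fun ω hω => ⟨?_, hω⟩))
      simp [labelGraph])
  have hB₂ := prob_process_le (V := V) (t := N) (t₁ := s₂) (t₂ := s₂) (c := 1 / 4) (a := {0, 1})
    (b := Set.univ) hm0 (E := fun G _ => ¬ PropD G) (fun _ _ _ _ h _ hD h' => hD (h'.mono h))
    (by simp) le_rfl le_rfl (by norm_num) (by
      refine le_trans (by norm_num) (hle₂.trans (prb_mono hm0 fun ω hω => ⟨hω, ?_⟩))
      have : labelGraph Set.univ ω = ⊤ := by ext u v; simp [labelGraph_adj]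
      rw [this, ncard_edgeSet_top]; exact ht₂)
  have hB₃ : prob (processLaw V N) {g | s₁ ≤ s₂ ∧ ¬ WellSpread (g s₁) (g s₂)}
      ≤ ENNReal.ofReal (prb m (fun ω : Sym2 V → Fin 3 =>
          ¬ WellSpread (labelGraph {0} ω) (labelGraph {0, 1} ω)) / (1 / 2)) := by
    by_cases h12 : s₁ ≤ s₂
    · have := prob_process_le (V := V) (t := N) (t₁ := s₁) (t₂ := s₂) (c := 1 / 2) (a := {0})
        (b := {0, 1}) hm0 (E := fun G₁ G₂ => ¬ WellSpread G₁ G₂)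
        (fun _ _ _ _ h h' hW hW' => hW (hW'.mono h h')) (by simp) le_rfl h12 (by norm_num)
        (le_trans (by norm_num) (le_prb_and hm0 hm hle₁ hge₂))
      simpa [h12] using this
    · simp [h12, prob]
  have hcover : (processLaw V N).support ⊆ {g | hittingTime PropD g = hittingTime PropR g} ∪
      ({g | PropD (g s₁)} ∪ ({g | ¬ PropD (g s₂)} ∪
        {g | s₁ ≤ s₂ ∧ ¬ WellSpread (g s₁) (g s₂)})) := by
    intro g hg
    obtain ⟨hmono, -⟩ := of_mem_support_processLaw le_rfl hg
    simp only [Set.mem_union, Set.mem_ofPred_eq]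
    by_cases h1 : PropD (g s₁)
    · exact Or.inr (Or.inl h1)
    by_cases h2 : PropD (g s₂)
    · have h12 : s₁ ≤ s₂ := by
        by_contra hlt
        exact h1 (h2.mono (hmono (not_le.1 hlt).le))
      by_cases h3 : WellSpread (g s₁) (g s₂)
      · exact Or.inl (hittingTime_eq hmono h1 h2 h3)
      · exact Or.inr (Or.inr (Or.inr ⟨h12, h3⟩))
    · exact Or.inr (Or.inr (Or.inl h2))
  rw [← PMF.toOuterMeasure_apply_eq_one_iff] at hcover
  rw [← hcover]
  refine (MeasureTheory.measure_union_le _ _).trans (add_le_add le_rfl ?_)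
  refine (MeasureTheory.measure_union_le _ _).trans (add_le_add hB₁ ?_)
  exact (MeasureTheory.measure_union_le _ _).trans (add_le_add hB₂ hB₃)

end HittingTimes

end RainbowProcess

end

theorem theorem2 :
    Tendsto
      (fun n : ℕ => RainbowProcess.prob (RainbowProcess.randomGraphProcess n)
        {g | RainbowProcess.hittingTime RainbowProcess.PropD g =
          RainbowProcess.hittingTime RainbowProcess.PropR g})
      atTop (𝓝 1) := by
  have hlim : ∀ {φ : ℕ → ℝ} (c : ℝ), Tendsto φ atTop (𝓝 0) →
      Tendsto (fun n => ENNReal.ofReal (φ n / c)) atTop (𝓝 0) := fun c h => by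
    have h1 := ENNReal.tendsto_ofReal (h.div_const c)
    simpa using h1
  have herr := (hlim (1 / 4) RainbowProcess.tendsto_prb_propD).add
    ((hlim (1 / 4) RainbowProcess.tendsto_prb_not_propD).add
      (hlim (1 / 2) RainbowProcess.tendsto_prb_not_wellSpread))
  have hlow := ENNReal.Tendsto.sub (tendsto_const_nhds (x := (1 : ENNReal))) herr
    (Or.inl ENNReal.one_ne_top)
  simp only [add_zero, tsub_zero] at hlow
  refine tendsto_of_tendsto_of_tendsto_of_le_of_le' hlow tendsto_const_nhds ?_ ?_
  · filter_upwards [RainbowProcess.eventually_labelWeights_nonneg] with n hn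
    -- `randomGraphProcess n` is `processLaw (Fin n) (n.choose 2)`
    have h := RainbowProcess.one_le_prob_add (V := Fin n) hn (RainbowProcess.sum_labelWeights n)
    rw [Fintype.card_fin] at h
    exact tsub_le_iff_right.2 h
  · refine Filter.Eventually.of_forall fun n => ?_
    refine (MeasureTheory.measure_mono (Set.subset_univ _)).trans (le_of_eq ?_)
    rw [PMF.toOuterMeasure_apply_eq_one_iff]
    exact Set.subset_univ _
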